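/- Let $L>0$ and $a>0$ be real numbers, and let $b,c,d\in L^\infty(0,L)$ be real functions satisfying one of the following, where $b_0,d_0>0$ and $c_0\in\mathbb R\setminus\{0\}$ are constants and $\chi_I$ is the indicator function of $I$: - (C1) $b=b_0\chi_{(b_1,b_2)}$, $c=c_0\chi_{(c_1,c_2)}$, $d=d_0\chi_{(d_1,d_2)}$ with $0<b_1<b_2<c_1<c_2<d_1<d_2<L$; - (C2) $b=b_0\chi_{(b_1,b_2)}$, $c=c_0\chi_{(c_1,c_2)}$, $d=d_0\chi_{(d_1,d_2)}$ with $0<b_1<b_2<d_1<d_2<c_1<c_2<L$; - (C3) $b=b_0\chi_{(b_1,b_2)}$, $c=c_0\chi_{(c_1,c_2)}$, $d=0$ with $0<b_1<b_2<c_1<c_2<L$. Let $\mathcal H=(H^1_0(0,L)\times L^2(0,L))^2$ (complex-valued functions) be the Hilbert space with inner product $$(U,U_1)_{\mathcal H}=\int_0^L v\overline{v_1}\,dx+a\int_0^L u_x\overline{(u_1)_x}\,dx+\int_0^L z\overline{z_1}\,dx+\int_0^L y_x\overline{(y_1)_x}\,dx$$ for $U=(u,v,y,z)$, $U_1=(u_1,v_1,y_1,z_1)$.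 Let $\mathcal A:D(\mathcal A)\subset\mathcal H\to\mathcal H$ be the operator $$\mathcal A(u,v,y,z)=\bigl(v,\ (au_x+bv_x)_x-cz,\ z,\ (y_x+dz_x)_x+cv\bigr),$$ $$D(\mathcal A)=\{(u,v,y,z)\in\mathcal H:\ v,z\in H^1_0(0,L),\ (au_x+bv_x)_x\in L^2(0,L),\ (y_x+dz_x)_x\in L^2(0,L)\},$$ with derivatives in the weak sense. Then: 1. $\mathcal A$ is m-dissipative in $\mathcal H$: $\operatorname{Re}(\mathcal AU,U)_{\mathcal H}\le 0$ for all $U\in D(\mathcal A)$, and $\lambda I-\mathcal A:D(\mathcal A)\to\mathcal H$ is onto for every $\lambda>0$. 2. $\mathcal A$ is the infinitesimal generator of a $C_0$-semigroup of contractions $(e^{t\mathcal A})_{t\ge0}$ on $\mathcal H$. 3. For every $U_0\in\mathcal H$, the problem $U_t=\mathcal AU$, $U(0)=U_0$ has a unique weak solution $U\in C^0(\mathbb R_+,\mathcal H)$, namely $U(t)=e^{t\mathcal A}U_0$. Here a weak solution is a function $U\in C^0(\mathbb R_+,\mathcal H)$ with $U(0)=U_0$ and $(U(t),\Phi)_{\mathcal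 H}=(U_0,\Phi)_{\mathcal H}+\int_0^t(U(s),\mathcal A^*\Phi)_{\mathcal H}\,ds$ for all $\Phi\in D(\mathcal A^*)$ and $t\ge0$. 4. If moreover $U_0\in D(\mathcal A)$, then this problem has a unique strong solution $U\in C^0(\mathbb R_+,D(\mathcal A))\cap C^1(\mathbb R_+,\mathcal H)$ (that is, $U_t(t)=\mathcal AU(t)$ for all $t\ge0$ and $U(0)=U_0$, where $D(\mathcal A)$ carries the graph norm), namely $U(t)=e^{t\mathcal A}U_0$. -/

import Mathlib

open MeasureTheory Set Filter Topology Distributions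
open scoped ENNReal InnerProductSpace ContDiff

noncomputable section

namespace CoupledWave

/-! ### Function spaces on the interval `(0, L)` -/

/-- The open interval `(0, L)`. -/
def interval (L : ℝ) : TopologicalSpace.Opens ℝ := ⟨Ioo 0 L, isOpen_Ioo⟩

/-- Lebesgue measure on `(0, L)`. -/
abbrev leb (L : ℝ) : Measure ℝ := volume.restrict (Ioo 0 L)

/-- The complex space `L²(0, L)`. -/
abbrev L2 (L : ℝ) : Type := Lp ℂ 2 (leb L)

/-- The real space `L^∞(0, L)`. -/
abbrev Linf (L : ℝ) : Type := Lp ℝ ⊤ (leb L)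

/-- `g` is the weak derivative of `w` on `(0, L)`: `∫ w φ' = - ∫ g φ` for all `φ ∈ C_c^∞(0, L)`. -/
def HasWeakDeriv {L : ℝ} (w g : L2 L) : Prop :=
  ∀ φ : 𝓓(interval L, ℂ), ∫ x, w x * deriv φ x ∂(leb L) = -∫ x, g x * φ x ∂(leb L)

lemma TestFunction.differentiable {L : ℝ} (φ : 𝓓(interval L, ℂ)) : Differentiable ℝ φ :=
  φ.contDiff.differentiable (by simp)

lemma TestFunction.continuous_deriv {L : ℝ} (φ : 𝓓(interval L, ℂ)) : Continuous (deriv φ) :=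
  φ.contDiff.continuous_deriv (by simp)

lemma TestFunction.memLp {L : ℝ} (φ : 𝓓(interval L, ℂ)) (p : ℝ≥0∞) : MemLp φ p (leb L) :=
  φ.continuous.memLp_of_hasCompactSupport φ.hasCompactSupport

lemma TestFunction.memLp_deriv {L : ℝ} (φ : 𝓓(interval L, ℂ)) (p : ℝ≥0∞) :
    MemLp (deriv φ) p (leb L) :=
  (TestFunction.continuous_deriv φ).memLp_of_hasCompactSupport φ.hasCompactSupport.deriv

lemma L2.integrable_mul {L : ℝ} (w : L2 L) {f : ℝ → ℂ} (hf : MemLp f 2 (leb L)) :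
    Integrable (fun x => w x * f x) (leb L) :=
  (Lp.memLp w).integrable_mul hf

lemma HasWeakDeriv.add {L : ℝ} {w₁ g₁ w₂ g₂ : L2 L} (h₁ : HasWeakDeriv w₁ g₁)
    (h₂ : HasWeakDeriv w₂ g₂) : HasWeakDeriv (w₁ + w₂) (g₁ + g₂) := by
  intro φ
  have e₁ : ∫ x, (w₁ + w₂ : L2 L) x * deriv φ x ∂(leb L)
      = ∫ x, (w₁ x * deriv φ x + w₂ x * deriv φ x) ∂(leb L) := by
    refine integral_congr_ae ?_
    filter_upwards [Lp.coeFn_add w₁ w₂] with x hx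
    rw [hx, Pi.add_apply, add_mul]
  have e₂ : ∫ x, (g₁ + g₂ : L2 L) x * φ x ∂(leb L)
      = ∫ x, (g₁ x * φ x + g₂ x * φ x) ∂(leb L) := by
    refine integral_congr_ae ?_
    filter_upwards [Lp.coeFn_add g₁ g₂] with x hx
    rw [hx, Pi.add_apply, add_mul]
  rw [e₁, e₂, integral_add (L2.integrable_mul _ (TestFunction.memLp_deriv φ 2))
    (L2.integrable_mul _ (TestFunction.memLp_deriv φ 2)),
    integral_add (L2.integrable_mul _ (TestFunction.memLp φ 2))
    (L2.integrable_mul _ (TestFunction.memLp φ 2)), h₁ φ, h₂ φ]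
  ring

lemma HasWeakDeriv.smul {L : ℝ} {w g : L2 L} (k : ℂ) (h : HasWeakDeriv w g) :
    HasWeakDeriv (k • w) (k • g) := by
  intro φ
  have e₁ : ∫ x, (k • w : L2 L) x * deriv φ x ∂(leb L)
      = ∫ x, k * (w x * deriv φ x) ∂(leb L) := by
    refine integral_congr_ae ?_
    filter_upwards [Lp.coeFn_smul k w] with x hx
    rw [hx, Pi.smul_apply, smul_eq_mul, mul_assoc]
  have e₂ : ∫ x, (k • g : L2 L) x * φ x ∂(leb L)
      = ∫ x, k * (g x * φ x) ∂(leb L) := by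
    refine integral_congr_ae ?_
    filter_upwards [Lp.coeFn_smul k g] with x hx
    rw [hx, Pi.smul_apply, smul_eq_mul, mul_assoc]
  rw [e₁, e₂, integral_const_mul, integral_const_mul, h φ]
  ring

lemma HasWeakDeriv.zero {L : ℝ} : HasWeakDeriv (0 : L2 L) 0 := by
  intro φ
  have h : ∀ f : ℝ → ℂ, ∫ x, (0 : L2 L) x * f x ∂(leb L) = 0 := by
    intro f
    rw [← integral_zero ℝ ℂ (μ := leb L)]
    refine integral_congr_ae ?_
    filter_upwards [Lp.coeFn_zero ℂ 2 (leb L)] with x hx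
    rw [hx, Pi.zero_apply, zero_mul]
  rw [h, h, neg_zero]

/-- Weak derivatives are unique. -/
lemma HasWeakDeriv.unique {L : ℝ} {w g₁ g₂ : L2 L} (h₁ : HasWeakDeriv w g₁)
    (h₂ : HasWeakDeriv w g₂) : g₁ = g₂ := by
  have hfin : IsFiniteMeasure (leb L) := inferInstance
  have i₁ : Integrable g₁ (leb L) := (Lp.memLp g₁).integrable (by norm_num)
  have i₂ : Integrable g₂ (leb L) := (Lp.memLp g₂).integrable (by norm_num)
  have key : ∀ᵐ x ∂(volume : Measure ℝ), x ∈ Ioo 0 L → g₁ x - g₂ x = 0 := by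
    refine isOpen_Ioo.ae_eq_zero_of_integral_contDiff_smul_eq_zero
      (f := fun x => g₁ x - g₂ x) ?_ ?_
    · exact IntegrableOn.locallyIntegrableOn (i₁.sub i₂)
    · intro ψ hψ hc hs
      let φ : 𝓓(interval L, ℂ) :=
        { toFun := fun x => (ψ x : ℂ)
          contDiff' := Complex.ofRealCLM.contDiff.comp hψ
          hasCompactSupport' := hc.comp_left (g := fun r : ℝ => (r : ℂ)) (by simp)
          tsupport_subset' := (tsupport_comp_subset (g := fun r : ℝ => (r : ℂ))
            (by simp) ψ).trans hs }
      have e := (h₁ φ).symm.trans (h₂ φ)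
      have e' : ∫ x, g₁ x * φ x ∂(leb L) = ∫ x, g₂ x * φ x ∂(leb L) := neg_injective e
      have e'' : ∫ x, (g₁ x * φ x - g₂ x * φ x) ∂(leb L) = 0 := by
        rw [integral_sub (L2.integrable_mul _ (TestFunction.memLp φ 2))
          (L2.integrable_mul _ (TestFunction.memLp φ 2)), e', sub_self]
      rw [← setIntegral_eq_integral_of_forall_compl_eq_zero (s := Ioo 0 L), ← e'']
      · refine integral_congr_ae (Eventually.of_forall fun x => ?_)
        change ψ x • (g₁ x - g₂ x) = g₁ x * (ψ x : ℂ) - g₂ x * (ψ x : ℂ)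
        rw [Complex.real_smul]
        ring
      · intro x hx
        have : ψ x = 0 := image_eq_zero_of_notMem_tsupport fun hx' => hx (hs hx')
        simp [this]
  refine Lp.ext ?_
  have := (ae_restrict_iff' (measurableSet_Ioo (a := (0 : ℝ)) (b := L))).2 key
  filter_upwards [this] with x hx using sub_eq_zero.1 hx

/-- The Sobolev space `H¹(0, L)`, as a subspace of `L²(0, L)`. -/
def H1 (L : ℝ) : Submodule ℂ (L2 L) where
  carrier := {w | ∃ g : L2 L, HasWeakDeriv w g}
  add_mem' := by
    rintro _ _ ⟨g₁, h₁⟩ ⟨g₂, h₂⟩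
    exact ⟨g₁ + g₂, h₁.add h₂⟩
  zero_mem' := ⟨0, HasWeakDeriv.zero⟩
  smul_mem' := by
    rintro k _ ⟨g, h⟩
    exact ⟨k • g, h.smul k⟩

open Classical in
/-- The weak derivative `w_x ∈ L²(0, L)` of `w ∈ H¹(0, L)` (and `0` if `w ∉ H¹(0, L)`). -/
def weakDeriv {L : ℝ} (w : L2 L) : L2 L :=
  if h : ∃ g : L2 L, HasWeakDeriv w g then h.choose else 0

lemma hasWeakDeriv_weakDeriv {L : ℝ} {w : L2 L} (h : w ∈ H1 L) :
    HasWeakDeriv w (weakDeriv w) := by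
  have h' : ∃ g : L2 L, HasWeakDeriv w g := h
  rw [weakDeriv, dif_pos h']
  exact h'.choose_spec

lemma HasWeakDeriv.weakDeriv_eq {L : ℝ} {w g : L2 L} (h : HasWeakDeriv w g) :
    weakDeriv w = g :=
  (hasWeakDeriv_weakDeriv ⟨g, h⟩).unique h

lemma weakDeriv_add {L : ℝ} {w₁ w₂ : L2 L} (h₁ : w₁ ∈ H1 L) (h₂ : w₂ ∈ H1 L) :
    weakDeriv (w₁ + w₂) = weakDeriv w₁ + weakDeriv w₂ :=
  ((hasWeakDeriv_weakDeriv h₁).add (hasWeakDeriv_weakDeriv h₂)).weakDeriv_eq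

lemma weakDeriv_smul {L : ℝ} (k : ℂ) {w : L2 L} (h : w ∈ H1 L) :
    weakDeriv (k • w) = k • weakDeriv w :=
  ((hasWeakDeriv_weakDeriv h).smul k).weakDeriv_eq

lemma weakDeriv_zero {L : ℝ} : weakDeriv (0 : L2 L) = 0 := HasWeakDeriv.zero.weakDeriv_eq

/-- The pairs `(φ, φ')` with `φ ∈ C_c^∞(0, L)`, as elements of `L²(0, L) × L²(0, L)`. -/
def testGraph (L : ℝ) : Submodule ℂ (L2 L × L2 L) where
  carrier := {p | ∃ φ : 𝓓(interval L, ℂ), p.1 =ᵐ[leb L] φ ∧ p.2 =ᵐ[leb L] deriv φ}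
  add_mem' := by
    rintro p q ⟨φ, h₁, h₂⟩ ⟨ψ, k₁, k₂⟩
    refine ⟨φ + ψ, ?_, ?_⟩
    · filter_upwards [h₁, k₁, Lp.coeFn_add p.1 q.1] with x a b c
      rw [Prod.fst_add, c, Pi.add_apply, a, b]
      rfl
    · filter_upwards [h₂, k₂, Lp.coeFn_add p.2 q.2] with x a b c
      have : (⇑(φ + ψ) : ℝ → ℂ) = ⇑φ + ⇑ψ := by ext; simp
      rw [Prod.snd_add, c, this, deriv_add (TestFunction.differentiable φ x)
        (TestFunction.differentiable ψ x), Pi.add_apply, a, b]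
  zero_mem' := by
    refine ⟨0, ?_, ?_⟩
    · filter_upwards [Lp.coeFn_zero ℂ 2 (leb L)] with x a
      rw [Prod.fst_zero, a]
      rfl
    · filter_upwards [Lp.coeFn_zero ℂ 2 (leb L)] with x a
      have : (⇑(0 : 𝓓(interval L, ℂ)) : ℝ → ℂ) = fun _ => 0 := by ext; simp
      rw [Prod.snd_zero, a, this, deriv_const, Pi.zero_apply]
  smul_mem' := by
    rintro k p ⟨φ, h₁, h₂⟩
    refine ⟨k • φ, ?_, ?_⟩
    · filter_upwards [h₁, Lp.coeFn_smul k p.1] with x a c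
      rw [Prod.smul_fst, c, Pi.smul_apply, a]
      rfl
    · filter_upwards [h₂, Lp.coeFn_smul k p.2] with x a c
      have : (⇑(k • φ) : ℝ → ℂ) = k • ⇑φ := by ext; simp
      rw [Prod.smul_snd, c, this, deriv_const_smul k (TestFunction.differentiable φ x),
        Pi.smul_apply, a]

/-- `H₀¹(0, L)`: the closure of `C_c^∞(0, L)` for the `H¹` norm, that is, the set of those `u` in
`L²(0, L)` for which some `(u, g)` is a limit of pairs `(φₙ, φₙ')` in `L² × L²`; `g` is then the
weak derivative of `u`. -/
def H10 (L : ℝ) : Submodule ℂ (L2 L) :=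
  (testGraph L).topologicalClosure.map (LinearMap.fst ℂ (L2 L) (L2 L))


lemma TestFunction.eq_zero_of_notMem {L : ℝ} (φ : 𝓓(interval L, ℂ)) {x : ℝ} (hx : x ∉ Ioo 0 L) :
    φ x = 0 :=
  image_eq_zero_of_notMem_tsupport fun h => hx (φ.tsupport_subset h)

lemma TestFunction.deriv_eq_zero_of_notMem {L : ℝ} (φ : 𝓓(interval L, ℂ)) {x : ℝ}
    (hx : x ∉ Ioo 0 L) : deriv φ x = 0 :=
  image_eq_zero_of_notMem_tsupport fun h => hx (φ.tsupport_subset (tsupport_deriv_subset h))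

/-- The weak derivative of a test function is its derivative. -/
lemma hasWeakDeriv_of_mem_testGraph {L : ℝ} {p : L2 L × L2 L} (hp : p ∈ testGraph L) :
    HasWeakDeriv p.1 p.2 := by
  obtain ⟨φ, h₁, h₂⟩ := hp
  intro ψ
  have e₁ : ∫ x, p.1 x * deriv ψ x ∂(leb L) = ∫ x, φ x * deriv ψ x := by
    have e : ∫ x, φ x * deriv ψ x ∂(leb L) = ∫ x, φ x * deriv ψ x :=
      setIntegral_eq_integral_of_forall_compl_eq_zero fun x hx => by
        rw [TestFunction.eq_zero_of_notMem φ hx, zero_mul]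
    rw [← e]
    refine integral_congr_ae ?_
    filter_upwards [h₁] with x hx
    rw [hx]
  have e₂ : ∫ x, p.2 x * ψ x ∂(leb L) = ∫ x, deriv φ x * ψ x := by
    have e : ∫ x, deriv φ x * ψ x ∂(leb L) = ∫ x, deriv φ x * ψ x :=
      setIntegral_eq_integral_of_forall_compl_eq_zero fun x hx => by
        rw [TestFunction.eq_zero_of_notMem ψ hx, mul_zero]
    rw [← e]
    refine integral_congr_ae ?_
    filter_upwards [h₂] with x hx
    rw [hx]
  rw [e₁, e₂]
  refine integral_mul_deriv_eq_deriv_mul_of_integrable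
    (fun x _ => (TestFunction.differentiable φ x).hasDerivAt)
    (fun x _ => (TestFunction.differentiable ψ x).hasDerivAt) ?_ ?_ ?_
  · exact (φ.continuous.mul (TestFunction.continuous_deriv ψ)).integrable_of_hasCompactSupport
      φ.hasCompactSupport.mul_right
  · exact ((TestFunction.continuous_deriv φ).mul ψ.continuous).integrable_of_hasCompactSupport
      ψ.hasCompactSupport.mul_left
  · exact (φ.continuous.mul ψ.continuous).integrable_of_hasCompactSupport
      φ.hasCompactSupport.mul_right

lemma continuous_integral_mul {L : ℝ} {f : ℝ → ℂ} (hf : MemLp f 2 (leb L)) :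
    Continuous fun w : L2 L => ∫ x, w x * f x ∂(leb L) := by
  have h : (fun w : L2 L => ∫ x, w x * f x ∂(leb L))
      = fun w : L2 L => ⟪(hf.star).toLp _, w⟫_ℂ := by
    funext w
    rw [L2.inner_def]
    refine integral_congr_ae ?_
    filter_upwards [MemLp.coeFn_toLp hf.star] with x hx
    rw [hx]
    simp [RCLike.inner_apply]
  rw [h]
  exact continuous_const.inner continuous_id

/-- The graph of the weak derivative is closed. -/
lemma isClosed_hasWeakDeriv (L : ℝ) :
    IsClosed {p : L2 L × L2 L | HasWeakDeriv p.1 p.2} := by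
  have : {p : L2 L × L2 L | HasWeakDeriv p.1 p.2}
      = ⋂ φ : 𝓓(interval L, ℂ), {p : L2 L × L2 L |
        ∫ x, p.1 x * deriv φ x ∂(leb L) = -∫ x, p.2 x * φ x ∂(leb L)} := by
    ext p
    simp [HasWeakDeriv]
  rw [this]
  exact isClosed_iInter fun φ => isClosed_eq
    ((continuous_integral_mul (TestFunction.memLp_deriv φ 2)).comp continuous_fst)
    ((continuous_integral_mul (TestFunction.memLp φ 2)).comp continuous_snd).neg

lemma hasWeakDeriv_of_mem_closure {L : ℝ} {p : L2 L × L2 L}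
    (hp : p ∈ (testGraph L).topologicalClosure) : HasWeakDeriv p.1 p.2 :=
  closure_minimal (s := (testGraph L : Set (L2 L × L2 L)))
    (fun _ hq => hasWeakDeriv_of_mem_testGraph hq) (isClosed_hasWeakDeriv L) hp

lemma mem_H10_iff {L : ℝ} {u : L2 L} :
    u ∈ H10 L ↔ (u, weakDeriv u) ∈ (testGraph L).topologicalClosure := by
  constructor
  · rintro ⟨p, hp, rfl⟩
    have h := (hasWeakDeriv_of_mem_closure hp).weakDeriv_eq
    change (p.1, weakDeriv p.1) ∈ _
    rw [h]
    exact hp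
  · exact fun h => ⟨_, h, rfl⟩

lemma H10_le_H1 (L : ℝ) : H10 L ≤ H1 L := fun _ hu =>
  ⟨_, hasWeakDeriv_of_mem_closure (mem_H10_iff.1 hu)⟩

lemma integral_norm_le {L : ℝ} (w : L2 L) :
    ∫ x, ‖w x‖ ∂(leb L) ≤ ‖w‖ * ((leb L) univ).toReal ^ (2 : ℝ)⁻¹ := by
  rw [integral_norm_eq_lintegral_enorm (Lp.aestronglyMeasurable w),
    ← eLpNorm_one_eq_lintegral_enorm, Lp.norm_def, ENNReal.toReal_rpow, ← ENNReal.toReal_mul]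
  refine ENNReal.toReal_mono ?_ ?_
  · exact ENNReal.mul_ne_top (Lp.eLpNorm_ne_top _)
      (ENNReal.rpow_ne_top_of_nonneg (by norm_num) (measure_ne_top _ _))
  · have := eLpNorm_le_eLpNorm_mul_rpow_measure_univ (p := 1) (q := 2) (μ := leb L)
      (by norm_num) (Lp.aestronglyMeasurable w)
    convert this using 3
    norm_num

lemma TestFunction.norm_le {L : ℝ} (φ : 𝓓(interval L, ℂ)) (x : ℝ) :
    ‖φ x‖ ≤ ∫ y, ‖deriv φ y‖ ∂(leb L) := by
  have hint : Integrable (deriv φ) :=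
    (TestFunction.continuous_deriv φ).integrable_of_hasCompactSupport φ.hasCompactSupport.deriv
  have e : ∫ y in Iic x, deriv φ y = φ x :=
    φ.hasCompactSupport.integral_Iic_deriv_eq (φ.contDiff.of_le (by simp)) x
  have e' : ∫ y, ‖deriv φ y‖ ∂(leb L) = ∫ y, ‖deriv φ y‖ :=
    setIntegral_eq_integral_of_forall_compl_eq_zero fun y hy => by
      rw [TestFunction.deriv_eq_zero_of_notMem φ hy, norm_zero]
  rw [← e, e']
  exact (norm_integral_le_integral_norm _).trans
    (setIntegral_le_integral hint.norm (Eventually.of_forall fun _ => norm_nonneg _))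

lemma norm_fst_le_of_mem_testGraph {L : ℝ} {p : L2 L × L2 L} (hp : p ∈ testGraph L) :
    ‖p.1‖ ≤ (((leb L) univ).toReal ^ (2 : ℝ)⁻¹ * ((leb L) univ).toReal ^ (2 : ℝ)⁻¹ + 1)
      * ‖p.2‖ := by
  obtain ⟨φ, h₁, h₂⟩ := hp
  have e : ∫ y, ‖deriv φ y‖ ∂(leb L) = ∫ y, ‖p.2 y‖ ∂(leb L) := by
    refine integral_congr_ae ?_
    filter_upwards [h₂] with y hy
    rw [hy]
  have hI := integral_norm_le p.2
  have hb : ∀ᵐ x ∂(leb L), ‖p.1 x‖ ≤ ∫ y, ‖p.2 y‖ ∂(leb L) := by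
    filter_upwards [h₁] with x hx
    rw [hx, ← e]
    exact TestFunction.norm_le φ x
  have hp1 := Lp.norm_le_of_ae_bound (integral_nonneg fun _ => norm_nonneg _) hb
  have hp2 : ‖p.1‖ ≤ ((leb L) univ).toReal ^ (2 : ℝ)⁻¹ * ∫ y, ‖p.2 y‖ ∂(leb L) := by
    simpa [measureUnivNNReal, ENNReal.coe_toNNReal_eq_toReal] using hp1
  have hm0 : 0 ≤ ((leb L) univ).toReal ^ (2 : ℝ)⁻¹ := by positivity
  have h3 := mul_le_mul_of_nonneg_left hI hm0
  have h4 := norm_nonneg p.2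
  calc _ ≤ _ := hp2
    _ ≤ _ := h3
    _ ≤ _ := by linarith

lemma norm_fst_le_of_mem_closure {E : Type*} [NormedAddCommGroup E] {S : Set (E × E)} {K : ℝ}
    (h : ∀ p ∈ S, ‖p.1‖ ≤ K * ‖p.2‖) {p : E × E} (hp : p ∈ closure S) : ‖p.1‖ ≤ K * ‖p.2‖ :=
  closure_minimal (t := {p : E × E | ‖p.1‖ ≤ K * ‖p.2‖}) h
    (isClosed_le continuous_fst.norm (continuous_const.mul continuous_snd.norm)) hp

/-- The Poincaré inequality on `(0, L)`. -/
lemma exists_poincare (L : ℝ) :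
    ∃ C : ℝ, 0 < C ∧ ∀ u ∈ H10 L, ‖u‖ ≤ C * ‖weakDeriv u‖ := by
  obtain ⟨K, hK, h⟩ : ∃ K : ℝ, 0 < K ∧ ∀ p ∈ testGraph L, ‖p.1‖ ≤ K * ‖p.2‖ :=
    ⟨_, by positivity, fun _ hp => norm_fst_le_of_mem_testGraph hp⟩
  exact ⟨K, hK, fun u hu => norm_fst_le_of_mem_closure (p := (u, weakDeriv u)) h
    (mem_H10_iff.1 hu)⟩

/-- The weak derivative as a linear map on `H₀¹(0, L)`. -/
def dx {L : ℝ} : H10 L →ₗ[ℂ] L2 L where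
  toFun u := weakDeriv (u : L2 L)
  map_add' u w := weakDeriv_add (H10_le_H1 L u.2) (H10_le_H1 L w.2)
  map_smul' k u := weakDeriv_smul k (H10_le_H1 L u.2)

/-! ### The energy space -/

/-- The energy space `(H₀¹(0, L) × L²(0, L))²`, with elements `U = (u, v, y, z)`; its norm, which
is given below, depends on `a`. -/
@[nolint unusedArguments]
def EnergySpace (_a L : ℝ) : Type := H10 L × L2 L × H10 L × L2 L

namespace EnergySpace

variable {a L : ℝ}

instance : AddCommGroup (EnergySpace a L) :=
  inferInstanceAs (AddCommGroup (H10 L × L2 L × H10 L × L2 L))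

instance : Module ℂ (EnergySpace a L) :=
  inferInstanceAs (Module ℂ (H10 L × L2 L × H10 L × L2 L))

/-- The element `(u, v, y, z)` of the energy space. -/
def mk (u : H10 L) (v : L2 L) (y : H10 L) (z : L2 L) : EnergySpace a L := (u, v, y, z)

/-- The first component. -/
def u (U : EnergySpace a L) : H10 L := U.1
/-- The second component. -/
def v (U : EnergySpace a L) : L2 L := U.2.1
/-- The third component. -/
def y (U : EnergySpace a L) : H10 L := U.2.2.1
/-- The fourth component. -/
def z (U : EnergySpace a L) : L2 L := U.2.2.2

@[ext] lemma ext {U W : EnergySpace a L} (hu : U.u = W.u) (hv : U.v = W.v) (hy : U.y = W.y)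
    (hz : U.z = W.z) : U = W :=
  Prod.ext hu (Prod.ext hv (Prod.ext hy hz))

@[simp] lemma u_mk (u : H10 L) (v y z) : (mk u v y z : EnergySpace a L).u = u := rfl
@[simp] lemma v_mk (u : H10 L) (v y z) : (mk u v y z : EnergySpace a L).v = v := rfl
@[simp] lemma y_mk (u : H10 L) (v y z) : (mk u v y z : EnergySpace a L).y = y := rfl
@[simp] lemma z_mk (u : H10 L) (v y z) : (mk u v y z : EnergySpace a L).z = z := rfl
@[simp] lemma u_zero : (0 : EnergySpace a L).u = 0 := rfl
@[simp] lemma v_zero : (0 : EnergySpace a L).v = 0 := rfl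
@[simp] lemma y_zero : (0 : EnergySpace a L).y = 0 := rfl
@[simp] lemma z_zero : (0 : EnergySpace a L).z = 0 := rfl
@[simp] lemma u_add (U W : EnergySpace a L) : (U + W).u = U.u + W.u := rfl
@[simp] lemma v_add (U W : EnergySpace a L) : (U + W).v = U.v + W.v := rfl
@[simp] lemma y_add (U W : EnergySpace a L) : (U + W).y = U.y + W.y := rfl
@[simp] lemma z_add (U W : EnergySpace a L) : (U + W).z = U.z + W.z := rfl
@[simp] lemma u_sub (U W : EnergySpace a L) : (U - W).u = U.u - W.u := rfl
@[simp] lemma v_sub (U W : EnergySpace a L) : (U - W).v = U.v - W.v := rfl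
@[simp] lemma y_sub (U W : EnergySpace a L) : (U - W).y = U.y - W.y := rfl
@[simp] lemma z_sub (U W : EnergySpace a L) : (U - W).z = U.z - W.z := rfl
@[simp] lemma u_smul (k : ℂ) (U : EnergySpace a L) : (k • U).u = k • U.u := rfl
@[simp] lemma v_smul (k : ℂ) (U : EnergySpace a L) : (k • U).v = k • U.v := rfl
@[simp] lemma y_smul (k : ℂ) (U : EnergySpace a L) : (k • U).y = k • U.y := rfl
@[simp] lemma z_smul (k : ℂ) (U : EnergySpace a L) : (k • U).z = k • U.z := rfl

lemma dx_eq_zero {u : H10 L} (h : dx u = 0) : u = 0 := by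
  obtain ⟨C, -, hC⟩ := exists_poincare L
  have h1 := hC u u.2
  have h2 : weakDeriv (u : L2 L) = 0 := h
  rw [h2, norm_zero, mul_zero] at h1
  exact Subtype.ext (norm_le_zero_iff.1 h1)

/-- The inner product `∫ v v̄₁ + a ∫ u_x (ū₁)_x + ∫ z z̄₁ + ∫ y_x (ȳ₁)_x` of `U` and `U₁` (which is
`inner ℂ U₁ U`, since Mathlib's inner products are conjugate-linear in the first argument). -/
instance instInner : Inner ℂ (EnergySpace a L) where
  inner U₁ U := ⟪U₁.v, U.v⟫_ℂ + (a : ℂ) * ⟪dx U₁.u, dx U.u⟫_ℂ + ⟪U₁.z, U.z⟫_ℂ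
    + ⟪dx U₁.y, dx U.y⟫_ℂ

lemma inner_def (U₁ U : EnergySpace a L) :
    ⟪U₁, U⟫_ℂ = ⟪U₁.v, U.v⟫_ℂ + (a : ℂ) * ⟪dx U₁.u, dx U.u⟫_ℂ + ⟪U₁.z, U.z⟫_ℂ
      + ⟪dx U₁.y, dx U.y⟫_ℂ := rfl

lemma inner_self_eq (U : EnergySpace a L) : ⟪U, U⟫_ℂ =
    ((‖U.v‖ ^ 2 + a * ‖dx U.u‖ ^ 2 + ‖U.z‖ ^ 2 + ‖dx U.y‖ ^ 2 : ℝ) : ℂ) := by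
  rw [inner_def]
  simp only [inner_self_eq_norm_sq_to_K, Complex.coe_algebraMap]
  push_cast
  rfl

instance instCore [ha : Fact (0 < a)] : InnerProductSpace.Core ℂ (EnergySpace a L) where
  toInner := instInner
  conj_inner_symm U W := by
    simp only [inner_def, map_add, map_mul, inner_conj_symm, Complex.conj_ofReal]
  re_inner_nonneg U := by
    have h := ha.out
    rw [inner_self_eq, RCLike.re_eq_complex_re, Complex.ofReal_re]
    positivity
  add_left U W Z := by
    simp only [inner_def, u_add, v_add, y_add, z_add, map_add, inner_add_left]
    ring
  smul_left U W k := by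
    simp only [inner_def, u_smul, v_smul, y_smul, z_smul, map_smul, inner_smul_left]
    ring
  definite U hU := by
    have h := ha.out
    rw [inner_self_eq] at hU
    have hU' := Complex.ofReal_eq_zero.1 hU
    have h1 := sq_nonneg ‖U.v‖
    have h2 := mul_nonneg h.le (sq_nonneg ‖dx U.u‖)
    have h3 := sq_nonneg ‖U.z‖
    have h4 := sq_nonneg ‖dx U.y‖
    refine EnergySpace.ext ?_ ?_ ?_ ?_
    · have : a * ‖dx U.u‖ ^ 2 = 0 := by linarith
      exact dx_eq_zero (by simpa [h.ne'] using this)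
    · have : ‖U.v‖ ^ 2 = 0 := by linarith
      simpa using this
    · have : ‖dx U.y‖ ^ 2 = 0 := by linarith
      exact dx_eq_zero (by simpa using this)
    · have : ‖U.z‖ ^ 2 = 0 := by linarith
      simpa using this

instance [Fact (0 < a)] : NormedAddCommGroup (EnergySpace a L) :=
  InnerProductSpace.Core.toNormedAddCommGroup (𝕜 := ℂ)

instance [Fact (0 < a)] : InnerProductSpace ℂ (EnergySpace a L) :=
  InnerProductSpace.ofCore instCore.toCore

lemma norm_sq_eq [Fact (0 < a)] (U : EnergySpace a L) :
    ‖U‖ ^ 2 = ‖U.v‖ ^ 2 + a * ‖dx U.u‖ ^ 2 + ‖U.z‖ ^ 2 + ‖dx U.y‖ ^ 2 := by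
  have h : ((‖U‖ ^ 2 : ℝ) : ℂ) = ⟪U, U⟫_ℂ := by
    rw [inner_self_eq_norm_sq_to_K]
    exact Complex.ofReal_pow _ _
  exact Complex.ofReal_injective (h.trans (inner_self_eq U))

lemma norm_v_le [ha : Fact (0 < a)] (U : EnergySpace a L) : ‖U.v‖ ≤ 1 * ‖U‖ := by
  have h := ha.out
  rw [one_mul]
  refine le_of_pow_le_pow_left₀ two_ne_zero (norm_nonneg U) ?_
  rw [norm_sq_eq]
  have h2 := mul_nonneg h.le (sq_nonneg ‖dx U.u‖)
  nlinarith [sq_nonneg ‖U.z‖, sq_nonneg ‖dx U.y‖]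

lemma norm_z_le [ha : Fact (0 < a)] (U : EnergySpace a L) : ‖U.z‖ ≤ 1 * ‖U‖ := by
  have h := ha.out
  rw [one_mul]
  refine le_of_pow_le_pow_left₀ two_ne_zero (norm_nonneg U) ?_
  rw [norm_sq_eq]
  have h2 := mul_nonneg h.le (sq_nonneg ‖dx U.u‖)
  nlinarith [sq_nonneg ‖U.v‖, sq_nonneg ‖dx U.y‖]

lemma norm_dx_y_le [ha : Fact (0 < a)] (U : EnergySpace a L) : ‖dx U.y‖ ≤ 1 * ‖U‖ := by
  have h := ha.out
  rw [one_mul]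
  refine le_of_pow_le_pow_left₀ two_ne_zero (norm_nonneg U) ?_
  rw [norm_sq_eq]
  have h2 := mul_nonneg h.le (sq_nonneg ‖dx U.u‖)
  nlinarith [sq_nonneg ‖U.v‖, sq_nonneg ‖U.z‖]

lemma norm_dx_u_le [ha : Fact (0 < a)] (U : EnergySpace a L) :
    ‖dx U.u‖ ≤ (√a)⁻¹ * ‖U‖ := by
  have h := ha.out
  rw [inv_mul_eq_div, le_div_iff₀ (Real.sqrt_pos.2 h)]
  refine le_of_pow_le_pow_left₀ two_ne_zero (norm_nonneg U) ?_
  rw [norm_sq_eq, mul_pow, Real.sq_sqrt h.le]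
  nlinarith [sq_nonneg ‖U.v‖, sq_nonneg ‖U.z‖, sq_nonneg ‖dx U.y‖]

lemma exists_tendsto_of_cauchySeq_dx {u : ℕ → H10 L} (h : CauchySeq fun n => dx (u n)) :
    ∃ w : H10 L, Tendsto (fun n => dx (u n)) atTop (𝓝 (dx w)) := by
  obtain ⟨C, hC0, hC⟩ := exists_poincare L
  have hu : CauchySeq fun n => (u n : L2 L) := by
    rw [Metric.cauchySeq_iff] at h ⊢
    intro ε hε
    obtain ⟨N, hN⟩ := h (ε / C) (div_pos hε hC0)
    refine ⟨N, fun m hm n hn => ?_⟩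
    have h1 := hN m hm n hn
    rw [dist_eq_norm, ← map_sub, lt_div_iff₀ hC0] at h1
    rw [dist_eq_norm]
    have h2 := hC ((u m : L2 L) - u n) (u m - u n).2
    exact h2.trans_lt (by rw [mul_comm]; exact h1)
  obtain ⟨g, hg⟩ := cauchySeq_tendsto_of_complete h
  obtain ⟨w, hw⟩ := cauchySeq_tendsto_of_complete hu
  have hmem : (w, g) ∈ (testGraph L).topologicalClosure :=
    (testGraph L).isClosed_topologicalClosure.mem_of_tendsto (hw.prodMk_nhds hg)
      (Eventually.of_forall fun n => mem_H10_iff.1 (u n).2)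
  have hd : weakDeriv w = g := (hasWeakDeriv_of_mem_closure hmem).weakDeriv_eq
  refine ⟨⟨w, (w, g), hmem, rfl⟩, ?_⟩
  have : dx (⟨w, (w, g), hmem, rfl⟩ : H10 L) = g := hd
  rw [this]
  exact hg

/-- The energy space is a Hilbert space. -/
instance [ha : Fact (0 < a)] : CompleteSpace (EnergySpace a L) := by
  have cau : ∀ {f : EnergySpace a L → L2 L} {K : ℝ}, (∀ U W, f (U - W) = f U - f W) →
      (∀ U, ‖f U‖ ≤ K * ‖U‖) → ∀ {S : ℕ → EnergySpace a L}, CauchySeq S →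
      CauchySeq fun n => f (S n) := by
    intro f K hsub hK S hS
    have hl : LipschitzWith K.toNNReal f := LipschitzWith.of_dist_le_mul fun U W => by
      rw [dist_eq_norm, dist_eq_norm, ← hsub]
      exact (hK _).trans (mul_le_mul_of_nonneg_right (Real.le_coe_toNNReal K) (norm_nonneg _))
    exact hS.map hl.uniformContinuous
  refine Metric.complete_of_cauchySeq_tendsto fun S hS => ?_
  obtain ⟨v, hv⟩ := cauchySeq_tendsto_of_complete (cau (fun _ _ => rfl) norm_v_le hS)
  obtain ⟨z, hz⟩ := cauchySeq_tendsto_of_complete (cau (fun _ _ => rfl) norm_z_le hS)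
  obtain ⟨u, hu⟩ := exists_tendsto_of_cauchySeq_dx
    (cau (f := fun U => dx U.u) (fun _ _ => by rw [u_sub, map_sub]) norm_dx_u_le hS)
  obtain ⟨y, hy⟩ := exists_tendsto_of_cauchySeq_dx
    (cau (f := fun U => dx U.y) (fun _ _ => by rw [y_sub, map_sub]) norm_dx_y_le hS)
  refine ⟨mk u v y z, ?_⟩
  rw [tendsto_iff_norm_sub_tendsto_zero] at hv hz hu hy ⊢
  have h2 : Tendsto (fun n => ‖S n - mk u v y z‖ ^ 2) atTop (𝓝 0) := by
    have e : (fun n => ‖S n - mk u v y z‖ ^ 2) = fun n => ‖(S n).v - v‖ ^ 2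
        + a * ‖dx (S n).u - dx u‖ ^ 2 + ‖(S n).z - z‖ ^ 2 + ‖dx (S n).y - dx y‖ ^ 2 := by
      funext n
      rw [norm_sq_eq]
      simp only [u_sub, v_sub, y_sub, z_sub, u_mk, v_mk, y_mk, z_mk, map_sub]
    rw [e]
    simpa using (((hv.pow 2).add ((hu.pow 2).const_mul a)).add (hz.pow 2)).add (hy.pow 2)
  have h3 := (Real.continuous_sqrt.tendsto 0).comp h2
  simpa [Function.comp_def] using h3

end EnergySpace

/-! ### The operator -/

/-- Multiplication of an `L²` function by a real `L^∞` function. -/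
def mulLinf {L : ℝ} (b : Linf L) : L2 L →ₗ[ℂ] L2 L where
  toFun w := (b • w : L2 L)
  map_add' w₁ w₂ := Lp.add_smul b w₁ w₂
  map_smul' k w := by
    refine Lp.ext ?_
    filter_upwards [Lp.coeFn_lpSMul (r := 2) b (k • w), Lp.coeFn_smul k w,
      Lp.coeFn_smul k (b • w : L2 L), Lp.coeFn_lpSMul (r := 2) b w] with x h₁ h₂ h₃ h₄
    rw [RingHom.id_apply, h₁, h₃, Pi.smul_apply', h₂, Pi.smul_apply, Pi.smul_apply, h₄,
      Pi.smul_apply', smul_comm]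

/-- The flux `κ u_x + b v_x`. -/
def flux {L : ℝ} (κ : ℝ) (b : Linf L) (u v : L2 L) : L2 L :=
  (κ : ℂ) • weakDeriv u + mulLinf b (weakDeriv v)

lemma flux_zero {L : ℝ} (κ : ℝ) (b : Linf L) : flux κ b 0 0 = 0 := by
  simp [flux, weakDeriv_zero]

lemma flux_add {L : ℝ} (κ : ℝ) (b : Linf L) {u v u' v' : L2 L} (hu : u ∈ H10 L) (hv : v ∈ H10 L)
    (hu' : u' ∈ H10 L) (hv' : v' ∈ H10 L) :
    flux κ b (u + u') (v + v') = flux κ b u v + flux κ b u' v' := by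
  simp only [flux, weakDeriv_add (H10_le_H1 L hu) (H10_le_H1 L hu'),
    weakDeriv_add (H10_le_H1 L hv) (H10_le_H1 L hv'), map_add, smul_add]
  abel

lemma flux_smul {L : ℝ} (κ : ℝ) (b : Linf L) (k : ℂ) {u v : L2 L} (hu : u ∈ H10 L)
    (hv : v ∈ H10 L) : flux κ b (k • u) (k • v) = k • flux κ b u v := by
  simp only [flux, weakDeriv_smul k (H10_le_H1 L hu), weakDeriv_smul k (H10_le_H1 L hv), map_smul,
    smul_add, smul_comm k]

/-- The domain `D(𝒜)`: those `U = (u, v, y, z)` in the energy space with `v, z ∈ H₀¹(0, L)`,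
`(a u_x + b v_x)_x ∈ L²(0, L)` and `(y_x + d z_x)_x ∈ L²(0, L)`. -/
def waveDomain {L : ℝ} (a : ℝ) (b d : Linf L) : Submodule ℂ (EnergySpace a L) where
  carrier := {U | U.v ∈ H10 L ∧ U.z ∈ H10 L ∧ flux a b U.u U.v ∈ H1 L ∧ flux 1 d U.y U.z ∈ H1 L}
  add_mem' := by
    rintro U W ⟨h₁, h₂, h₃, h₄⟩ ⟨k₁, k₂, k₃, k₄⟩
    refine ⟨add_mem h₁ k₁, add_mem h₂ k₂, ?_, ?_⟩
    · simpa [flux_add a b U.u.2 h₁ W.u.2 k₁] using add_mem h₃ k₃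
    · simpa [flux_add 1 d U.y.2 h₂ W.y.2 k₂] using add_mem h₄ k₄
  zero_mem' := by
    refine ⟨zero_mem _, zero_mem _, ?_, ?_⟩ <;> simp [flux_zero]
  smul_mem' := by
    rintro k U ⟨h₁, h₂, h₃, h₄⟩
    refine ⟨Submodule.smul_mem _ k h₁, Submodule.smul_mem _ k h₂, ?_, ?_⟩
    · simpa [flux_smul a b k U.u.2 h₁] using Submodule.smul_mem _ k h₃
    · simpa [flux_smul 1 d k U.y.2 h₂] using Submodule.smul_mem _ k h₄

/-- The value `𝒜 U = (v, (a u_x + b v_x)_x - c z, z, (y_x + d z_x)_x + c v)` for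
`U = (u, v, y, z)` in `D(𝒜)`. -/
def waveFun {L a : ℝ} {b d : Linf L} (c : Linf L) (U : waveDomain a b d) : EnergySpace a L :=
  EnergySpace.mk
    ⟨U.1.v, U.2.1⟩
    (weakDeriv (flux a b U.1.u U.1.v) - mulLinf c U.1.z)
    ⟨U.1.z, U.2.2.1⟩
    (weakDeriv (flux 1 d U.1.y U.1.z) + mulLinf c U.1.v)

lemma waveFun_add {L a : ℝ} {b d : Linf L} (c : Linf L) (U W : waveDomain a b d) :
    waveFun c (U + W) = waveFun c U + waveFun c W := by
  refine EnergySpace.ext (Subtype.ext ?_) ?_ (Subtype.ext ?_) ?_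
  · simp only [waveFun, EnergySpace.u_mk, EnergySpace.u_add, Submodule.coe_add,
      EnergySpace.v_add]
  · simp only [waveFun, EnergySpace.v_mk, EnergySpace.u_add, Submodule.coe_add,
      EnergySpace.v_add, EnergySpace.z_add, map_add]
    rw [flux_add a b U.1.u.2 U.2.1 W.1.u.2 W.2.1, weakDeriv_add U.2.2.2.1 W.2.2.2.1]
    abel
  · simp only [waveFun, EnergySpace.y_mk, EnergySpace.y_add, Submodule.coe_add,
      EnergySpace.z_add]
  · simp only [waveFun, EnergySpace.z_mk, EnergySpace.y_add, Submodule.coe_add,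
      EnergySpace.v_add, EnergySpace.z_add, map_add]
    rw [flux_add 1 d U.1.y.2 U.2.2.1 W.1.y.2 W.2.2.1, weakDeriv_add U.2.2.2.2 W.2.2.2.2]
    abel

lemma waveFun_smul {L a : ℝ} {b d : Linf L} (c : Linf L) (k : ℂ) (U : waveDomain a b d) :
    waveFun c (k • U) = k • waveFun c U := by
  refine EnergySpace.ext (Subtype.ext ?_) ?_ (Subtype.ext ?_) ?_
  · simp only [waveFun, EnergySpace.u_mk, EnergySpace.u_smul, Submodule.coe_smul,
      EnergySpace.v_smul]
  · simp only [waveFun, EnergySpace.v_mk, EnergySpace.u_smul, Submodule.coe_smul,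
      EnergySpace.v_smul, EnergySpace.z_smul, map_smul]
    rw [flux_smul a b k U.1.u.2 U.2.1, weakDeriv_smul k U.2.2.2.1, smul_sub]
  · simp only [waveFun, EnergySpace.y_mk, EnergySpace.y_smul, Submodule.coe_smul,
      EnergySpace.z_smul]
  · simp only [waveFun, EnergySpace.z_mk, EnergySpace.y_smul, Submodule.coe_smul,
      EnergySpace.v_smul, EnergySpace.z_smul, map_smul]
    rw [flux_smul 1 d k U.1.y.2 U.2.2.1, weakDeriv_smul k U.2.2.2.2, smul_add]

/-- The unbounded operator
`𝒜 (u, v, y, z) = (v, (a u_x + b v_x)_x - c z, z, (y_x + d z_x)_x + c v)` with domain `D(𝒜)`. -/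
def waveOp {L : ℝ} (a : ℝ) (b c d : Linf L) : EnergySpace a L →ₗ.[ℂ] EnergySpace a L where
  domain := waveDomain a b d
  toFun :=
    { toFun := waveFun c
      map_add' := waveFun_add c
      map_smul' := waveFun_smul c }

/-! ### The coefficients -/

/-- The function `k χ_(p, q)` on `(0, L)`. -/
def step (L k p q : ℝ) : Linf L :=
  indicatorConstLp ⊤ (measurableSet_Ioo (a := p) (b := q)) (measure_ne_top (leb L) _) k

/-- Case C1. -/
def CaseC1 (L : ℝ) (b c d : Linf L) : Prop :=
  ∃ b₀ c₀ d₀ b₁ b₂ c₁ c₂ d₁ d₂ : ℝ, 0 < b₀ ∧ c₀ ≠ 0 ∧ 0 < d₀ ∧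
    0 < b₁ ∧ b₁ < b₂ ∧ b₂ < c₁ ∧ c₁ < c₂ ∧ c₂ < d₁ ∧ d₁ < d₂ ∧ d₂ < L ∧
    b = step L b₀ b₁ b₂ ∧ c = step L c₀ c₁ c₂ ∧ d = step L d₀ d₁ d₂

/-- Case C2. -/
def CaseC2 (L : ℝ) (b c d : Linf L) : Prop :=
  ∃ b₀ c₀ d₀ b₁ b₂ c₁ c₂ d₁ d₂ : ℝ, 0 < b₀ ∧ c₀ ≠ 0 ∧ 0 < d₀ ∧
    0 < b₁ ∧ b₁ < b₂ ∧ b₂ < d₁ ∧ d₁ < d₂ ∧ d₂ < c₁ ∧ c₁ < c₂ ∧ c₂ < L ∧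
    b = step L b₀ b₁ b₂ ∧ c = step L c₀ c₁ c₂ ∧ d = step L d₀ d₁ d₂

/-- Case C3. -/
def CaseC3 (L : ℝ) (b c d : Linf L) : Prop :=
  ∃ b₀ c₀ b₁ b₂ c₁ c₂ : ℝ, 0 < b₀ ∧ c₀ ≠ 0 ∧
    0 < b₁ ∧ b₁ < b₂ ∧ b₂ < c₁ ∧ c₁ < c₂ ∧ c₂ < L ∧
    b = step L b₀ b₁ b₂ ∧ c = step L c₀ c₁ c₂ ∧ d = 0

/-! ### Operators, semigroups and evolution equations in a Hilbert space -/

section Abstract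

variable {H : Type*} [NormedAddCommGroup H] [InnerProductSpace ℂ H]

/-- `A` is dissipative: `Re ⟨A x, x⟩ ≤ 0` on `D(A)`. -/
def IsDissipative (A : H →ₗ.[ℂ] H) : Prop :=
  ∀ x : A.domain, (⟪(x : H), A x⟫_ℂ).re ≤ 0

/-- `A` is m-dissipative: it is dissipative and `λ - A` is onto for all `λ > 0`. -/
def IsMDissipative (A : H →ₗ.[ℂ] H) : Prop :=
  IsDissipative A ∧ ∀ r : ℝ, 0 < r → ∀ f : H, ∃ x : A.domain, (r : ℂ) • (x : H) - A x = f

/-- `(T t)_{t ≥ 0}` is a `C₀`-semigroup of contractions (the values at `t < 0` are irrelevant). -/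
structure IsContractionC0Semigroup (T : ℝ → H →L[ℂ] H) : Prop where
  zero : T 0 = ContinuousLinearMap.id ℂ H
  add : ∀ s t : ℝ, 0 ≤ s → 0 ≤ t → T (s + t) = (T s).comp (T t)
  continuous : ∀ x : H, ContinuousOn (fun t => T t x) (Ici 0)
  contraction : ∀ t : ℝ, 0 ≤ t → ‖T t‖ ≤ 1

/-- `A` is the infinitesimal generator of `T`: `x ∈ D(A)` and `A x = y` if and only if
`(T t x - x) / t → y` as `t → 0⁺`. -/
def IsGenerator (A : H →ₗ.[ℂ] H) (T : ℝ → H →L[ℂ] H) : Prop :=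
  ∀ x y : H, (∃ hx : x ∈ A.domain, A ⟨x, hx⟩ = y) ↔
    Tendsto (fun t : ℝ => (t : ℂ)⁻¹ • (T t x - x)) (𝓝[>] 0) (𝓝 y)

/-- `U` is a weak solution of `U' = A U`, `U 0 = U₀` on `[0, ∞)`: it is continuous with values in
`H`, `U 0 = U₀`, and for every `φ ∈ D(A*)` the function `t ↦ ⟨φ, U t⟩` is the integral of
`t ↦ ⟨A* φ, U t⟩`. The adjoint enters through its graph: `φ ∈ D(A*)` and `A* φ = ψ` mean that
`⟨ψ, x⟩ = ⟨φ, A x⟩` for all `x ∈ D(A)`. -/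
structure IsWeakSolution (A : H →ₗ.[ℂ] H) (U₀ : H) (U : ℝ → H) : Prop where
  continuousOn : ContinuousOn U (Ici 0)
  initial : U 0 = U₀
  weak : ∀ φ ψ : H, (∀ x : A.domain, ⟪ψ, (x : H)⟫_ℂ = ⟪φ, A x⟫_ℂ) →
    ∀ t : ℝ, 0 ≤ t → ⟪φ, U t⟫_ℂ = ⟪φ, U₀⟫_ℂ + ∫ s in (0 : ℝ)..t, ⟪ψ, U s⟫_ℂ

/-- `U` is a strong solution of `U' = A U`, `U 0 = U₀` on `[0, ∞)`: it belongs to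
`C⁰([0, ∞), D(A)) ∩ C¹([0, ∞), H)`, where `D(A)` carries the graph norm, and it satisfies the
equation for every `t ≥ 0`. -/
structure IsStrongSolution (A : H →ₗ.[ℂ] H) (U₀ : H) (U : ℝ → H) : Prop where
  contDiffOn : ContDiffOn ℝ 1 U (Ici 0)
  initial : U 0 = U₀
  exists_domain : ∃ V : ℝ → A.domain, (∀ t : ℝ, 0 ≤ t → (V t : H) = U t) ∧
    ContinuousOn (fun t => ((V t : H), A (V t))) (Ici 0) ∧
    ∀ t : ℝ, 0 ≤ t → HasDerivWithinAt U (A (V t)) (Ici 0) t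

end Abstract

end CoupledWave

end

noncomputable section

namespace CoupledWave

/-! ### Energy estimate and exponentials of bounded dissipative operators. -/

section Abstract

variable {H : Type*} [NormedAddCommGroup H] [InnerProductSpace ℂ H]

/-! The theorem combines m-dissipativity of the wave operator with a Hilbert space form of the
Lumer–Phillips theorem.

Dissipativity is the energy identity `Re (𝒜U, U) = -∫ b |v_x|² - ∫ d |z_x|²`: the elastic terms and
the two coupling terms cancel in the real part, and in each of the three cases `b, d ≥ 0`. For
surjectivity of `r - 𝒜`, the first and third equations give `u` and `y` in terms of `v` and `z`.
What remains is a coercive variational problem for `(v, z)`, solved by Lax–Milgram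
(`exists_resolvent_variational`); its weak form then shows that the fluxes lie in `H¹`
(`hasWeakDeriv_flux`).

On the abstract side, the Yosida approximations `B n` of an m-dissipative `A` are bounded,
dissipative and commuting, and converge to `A` on its dense domain (`IsMDissipative.exists_yosida`).
Their exponentials are contractions whose differences are controlled by `‖B m x - B n x‖ t`, so they
converge to a semigroup satisfying `T t x = x + ∫₀ᵗ T s (A x) ds` on the domain. This identity
yields the generator and the strong solutions, and density yields the weak ones. Uniqueness
integrates the difference of two weak solutions in time: the integral lies in `D(A)` because `A** ⊆
A`, and the energy estimate below makes it vanish. -/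

lemma norm_le_of_re_inner_deriv_nonpos {f f' : ℝ → H}
    (hf : ∀ t, 0 ≤ t → HasDerivWithinAt f (f' t) (Ici 0) t)
    (h : ∀ t, 0 ≤ t → (⟪f t, f' t⟫_ℂ).re ≤ 0) {t : ℝ} (ht : 0 ≤ t) : ‖f t‖ ≤ ‖f 0‖ := by
  have hd : ∀ s, 0 ≤ s → HasDerivWithinAt (fun s => (⟪f s, f s⟫_ℂ).re)
      (⟪f s, f' s⟫_ℂ + ⟪f' s, f s⟫_ℂ).re (Ici 0) s := fun s hs =>
    Complex.reCLM.hasFDerivAt.comp_hasDerivWithinAt s ((hf s hs).inner ℂ (hf s hs))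
  have hanti : AntitoneOn (fun s => (⟪f s, f s⟫_ℂ).re) (Ici 0) := by
    refine antitoneOn_of_deriv_nonpos (convex_Ici 0)
      (fun s hs => (hd s hs).continuousWithinAt) ?_ ?_
    · intro s hs
      exact ((hd s (interior_subset hs)).mono interior_subset).differentiableWithinAt
    · intro s hs
      have hs0 : 0 ≤ s := interior_subset hs
      rw [((hd s hs0).hasDerivAt (mem_interior_iff_mem_nhds.1 hs)).deriv]
      have e : (⟪f' s, f s⟫_ℂ).re = (⟪f s, f' s⟫_ℂ).re := inner_re_symm (𝕜 := ℂ) _ _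
      rw [Complex.add_re, e]
      linarith [h s hs0]
  have h1 := hanti (self_mem_Ici (a := (0 : ℝ))) ht ht
  have e : ∀ x : H, (⟪x, x⟫_ℂ).re = ‖x‖ ^ 2 := fun x => inner_self_eq_norm_sq (𝕜 := ℂ) x
  simp only [e] at h1
  exact le_of_pow_le_pow_left₀ two_ne_zero (norm_nonneg _) h1

section Bounded

variable [CompleteSpace H]

/-- The uniformly continuous group `t ↦ e^{tB}` generated by a bounded operator. -/
def boundedGroup (B : H →L[ℂ] H) (t : ℝ) : H →L[ℂ] H := NormedSpace.exp (t • B)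

lemma boundedGroup_zero (B : H →L[ℂ] H) : boundedGroup B 0 = 1 := by
  simp [boundedGroup]

lemma boundedGroup_add (B : H →L[ℂ] H) (s t : ℝ) :
    boundedGroup B (s + t) = boundedGroup B s * boundedGroup B t := by
  let : NormedAlgebra ℚ (H →L[ℂ] H) := NormedAlgebra.restrictScalars ℚ ℝ _
  rw [boundedGroup, add_smul]
  exact NormedSpace.exp_add_of_commute
    (((Commute.refl B).smul_left s).smul_right t)

lemma hasDerivAt_boundedGroup_apply (B : H →L[ℂ] H) (x : H) (t : ℝ) :
    HasDerivAt (fun t => boundedGroup B t x) (boundedGroup B t (B x)) t := by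
  have h : HasDerivAt (boundedGroup B) (boundedGroup B t * B) t :=
    hasDerivAt_exp_smul_const B t
  exact ((ContinuousLinearMap.apply ℂ H x).restrictScalars ℝ).hasFDerivAt.comp_hasDerivAt t h

lemma hasDerivAt_boundedGroup_apply' (B : H →L[ℂ] H) (x : H) (t : ℝ) :
    HasDerivAt (fun t => boundedGroup B t x) (B (boundedGroup B t x)) t := by
  have h : HasDerivAt (boundedGroup B) (B * boundedGroup B t) t :=
    hasDerivAt_exp_smul_const' B t
  exact ((ContinuousLinearMap.apply ℂ H x).restrictScalars ℝ).hasFDerivAt.comp_hasDerivAt t h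

lemma norm_boundedGroup_apply_le {B : H →L[ℂ] H} (hB : ∀ x, (⟪x, B x⟫_ℂ).re ≤ 0) {t : ℝ}
    (ht : 0 ≤ t) (x : H) : ‖boundedGroup B t x‖ ≤ ‖x‖ := by
  have := norm_le_of_re_inner_deriv_nonpos (f := fun t => boundedGroup B t x)
    (fun s _ => (hasDerivAt_boundedGroup_apply' B x s).hasDerivWithinAt) (fun s _ => hB _) ht
  simpa [boundedGroup_zero] using this

/-- The path `s ↦ e^{(t-s)C} e^{sB} x` joins the two vectors. As `B` and `C` commute, its derivative
is `e^{(t-s)C} e^{sB} (B x - C x)`, and both exponentials are contractions. -/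
lemma norm_boundedGroup_sub_le {B C : H →L[ℂ] H} (hB : ∀ x, (⟪x, B x⟫_ℂ).re ≤ 0)
    (hC : ∀ x, (⟪x, C x⟫_ℂ).re ≤ 0) (hBC : Commute B C) {t : ℝ} (ht : 0 ≤ t) (x : H) :
    ‖boundedGroup B t x - boundedGroup C t x‖ ≤ ‖B x - C x‖ * t := by
  let : NormedAlgebra ℚ (H →L[ℂ] H) := NormedAlgebra.restrictScalars ℚ ℝ _
  -- The left form has a single `s`-dependent exponential to differentiate; the right form shows the
  -- contraction bound.
  have key : ∀ s : ℝ, boundedGroup C t * boundedGroup (B - C) s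
      = boundedGroup C (t - s) * boundedGroup B s := by
    intro s
    have c1 : Commute (t • C) (s • (B - C)) :=
      (((hBC.symm.sub_right (Commute.refl C)).smul_left t).smul_right s)
    have c2 : Commute ((t - s) • C) (s • B) := (hBC.symm.smul_left _).smul_right _
    rw [boundedGroup, boundedGroup, boundedGroup, boundedGroup,
      ← NormedSpace.exp_add_of_commute c1, ← NormedSpace.exp_add_of_commute c2]
    congr 1
    rw [smul_sub, sub_smul]
    abel
  have hd : ∀ s, HasDerivAt (fun s => (boundedGroup C t * boundedGroup (B - C) s) x)
      ((boundedGroup C t * boundedGroup (B - C) s) (B x - C x)) s := fun s =>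
    ((boundedGroup C t).restrictScalars ℝ).hasFDerivAt.comp_hasDerivAt s
      (hasDerivAt_boundedGroup_apply (B - C) x s)
  have := norm_image_sub_le_of_norm_deriv_le_segment'
    (fun s _ => (hd s).hasDerivWithinAt) (C := ‖B x - C x‖) (a := 0) (b := t) (fun s hs => ?_) t
    (right_mem_Icc.2 ht)
  · simpa [key, boundedGroup_zero] using this
  · rw [key]
    exact (norm_boundedGroup_apply_le hC (sub_nonneg.2 hs.2.le) _).trans
      (norm_boundedGroup_apply_le hB hs.1 _)

end Bounded

/-! ### Resolvents and Yosida approximations. -/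

variable {A : H →ₗ.[ℂ] H}

/-- Dissipativity gives `r ‖x‖² ≤ Re ⟨x, (r - A) x⟩`; then Cauchy–Schwarz and division by `‖x‖`. -/
lemma IsDissipative.norm_le (hA : IsDissipative A) {r : ℝ} (hr : 0 < r) (x : A.domain) :
    ‖(x : H)‖ ≤ r⁻¹ * ‖(r : ℂ) • (x : H) - A x‖ := by
  have h1 : r * ‖(x : H)‖ ^ 2 ≤ ‖(x : H)‖ * ‖(r : ℂ) • (x : H) - A x‖ := by
    have h2 := re_inner_le_norm (𝕜 := ℂ) (x : H) ((r : ℂ) • (x : H) - A x)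
    have h3 : (⟪(x : H), (x : H)⟫_ℂ).re = ‖(x : H)‖ ^ 2 := inner_self_eq_norm_sq (𝕜 := ℂ) _
    rw [inner_sub_right, inner_smul_right, RCLike.re_eq_complex_re, Complex.sub_re,
      Complex.re_ofReal_mul, h3] at h2
    linarith [hA x]
  rw [inv_mul_eq_div, le_div_iff₀ hr]
  rcases (norm_nonneg (x : H)).eq_or_lt with h | h
  · rw [← h, zero_mul]
    exact norm_nonneg _
  · nlinarith

lemma IsDissipative.eq_of_sub_eq (hA : IsDissipative A) {r : ℝ} (hr : 0 < r) {x y : A.domain}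
    (h : (r : ℂ) • (x : H) - A x = (r : ℂ) • (y : H) - A y) : x = y := by
  have h1 := hA.norm_le hr (x - y)
  have h2 : (r : ℂ) • ((x - y : A.domain) : H) - A (x - y) = 0 := by
    rw [A.map_sub, Submodule.coe_sub, smul_sub, sub_sub_sub_comm, h, sub_self]
  rw [h2, norm_zero, mul_zero] at h1
  exact sub_eq_zero.1 (Subtype.ext (norm_le_zero_iff.1 h1))

/-- Preimages under `r - A` are unique by dissipativity, so an arbitrary choice of them is
automatically linear. -/
lemma IsMDissipative.exists_resolvent (hA : IsMDissipative A) {r : ℝ} (hr : 0 < r) :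
    ∃ R : H →L[ℂ] H, (∀ f, ∃ hx : R f ∈ A.domain, (r : ℂ) • R f - A ⟨R f, hx⟩ = f) ∧
      (∀ x : A.domain, R ((r : ℂ) • (x : H) - A x) = x) ∧ ∀ f, ‖R f‖ ≤ r⁻¹ * ‖f‖ := by
  choose S hS using hA.2 r hr
  let R₀ : H →ₗ[ℂ] H :=
    { toFun := fun f => S f
      map_add' := fun f g => by
        rw [← Submodule.coe_add]
        refine congrArg _ (hA.1.eq_of_sub_eq hr ?_)
        rw [hS, A.map_add, Submodule.coe_add, smul_add, add_sub_add_comm, hS, hS]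
      map_smul' := fun k f => by
        rw [RingHom.id_apply, ← Submodule.coe_smul]
        refine congrArg _ (hA.1.eq_of_sub_eq hr ?_)
        rw [hS, A.map_smul, Submodule.coe_smul, smul_comm, ← smul_sub, hS] }
  have hb : ∀ f, ‖R₀ f‖ ≤ r⁻¹ * ‖f‖ := fun f => by
    have := hA.1.norm_le hr (S f)
    rwa [hS] at this
  refine ⟨R₀.mkContinuous r⁻¹ hb, fun f => ⟨(S f).2, hS f⟩, fun x => ?_, hb⟩
  exact congrArg Subtype.val (hA.1.eq_of_sub_eq hr (hS _))

section Complete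

variable [CompleteSpace H]

/-- If `w` is orthogonal to the domain and `y - A y = w`, pairing with `y` gives `‖y‖² = Re ⟨y, A y⟩
≤ 0`, so `w = 0`. -/
lemma IsMDissipative.dense_domain (hA : IsMDissipative A) : Dense (A.domain : Set H) := by
  rw [Submodule.dense_iff_topologicalClosure_eq_top, Submodule.topologicalClosure_eq_top_iff,
    Submodule.eq_bot_iff]
  intro w hw
  obtain ⟨y, hy⟩ := hA.2 1 one_pos w
  rw [Complex.ofReal_one, one_smul] at hy
  have h1 : ⟪(y : H), w⟫_ℂ = 0 := hw y y.2
  have h2 := hA.1 y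
  have h3 : (⟪(y : H), (y : H)⟫_ℂ).re = ‖(y : H)‖ ^ 2 := inner_self_eq_norm_sq (𝕜 := ℂ) _
  rw [← hy, inner_sub_right] at h1
  have h4 := congrArg Complex.re h1
  rw [Complex.sub_re, h3, Complex.zero_re] at h4
  have h5 : ‖(y : H)‖ ^ 2 = 0 := le_antisymm (by linarith) (sq_nonneg _)
  have h6 : y = 0 := Subtype.ext (by simpa using h5)
  rw [← hy, h6]
  simp

/-- The approximations are `B n = r (r R - 1)` with `r = n + 1` and `R = (r - A)⁻¹`; the shift by
one keeps `r` positive. On the domain, `B n x = r R (A x)`, and `r R → 1` strongly. -/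
lemma IsMDissipative.exists_yosida (hA : IsMDissipative A) :
    ∃ B : ℕ → H →L[ℂ] H, (∀ n x, (⟪x, B n x⟫_ℂ).re ≤ 0) ∧ (∀ m n, Commute (B m) (B n)) ∧
      ∀ x : A.domain, Tendsto (fun n => B n x) atTop (𝓝 (A x)) := by
  have hpos : ∀ n : ℕ, (0 : ℝ) < n + 1 := fun n => by positivity
  choose R hR₁ hR₂ hR₃ using fun n : ℕ => hA.exists_resolvent (hpos n)
  have hcomm : ∀ m n, Commute (R m) (R n) := by
    -- The resolvent identity; comparing it with its version for `m` and `n` exchanged gives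
    -- commutation.
    have hres : ∀ m n f, R n f = R m f + (((m + 1 : ℝ) : ℂ) - ((n + 1 : ℝ) : ℂ)) • R m (R n f) := by
      intro m n f
      obtain ⟨hx, h⟩ := hR₁ n f
      have h2 := hR₂ m ⟨R n f, hx⟩
      have h3 : (((m + 1 : ℝ) : ℂ)) • R n f - A ⟨R n f, hx⟩
          = f + (((m + 1 : ℝ) : ℂ) - ((n + 1 : ℝ) : ℂ)) • R n f := by
        nth_rewrite 3 [← h]
        rw [sub_smul]
        abel
      rw [h3, map_add, map_smul] at h2
      exact h2.symm
    intro m n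
    rcases eq_or_ne m n with rfl | hmn
    · exact Commute.refl _
    refine ContinuousLinearMap.ext fun f => ?_
    have hne : (((m + 1 : ℝ) : ℂ) - ((n + 1 : ℝ) : ℂ)) ≠ 0 := by
      push_cast
      rw [add_sub_add_right_eq_sub, sub_ne_zero]
      exact_mod_cast hmn
    have h1 := hres m n f
    have h2 := hres n m f
    refine smul_right_injective H hne ?_
    change _ • R m (R n f) = _ • R n (R m f)
    rw [← sub_eq_iff_eq_add'] at h1 h2
    rw [← h1, ← neg_sub (R m f), h2, ← neg_smul, neg_sub]
  have happ : ∀ n : ℕ, ∀ x : A.domain,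
      ((n + 1 : ℝ) : ℂ) • R n x - x = R n (A x) := by
    intro n x
    have h := hR₂ n x
    rw [map_sub, map_smul, sub_eq_iff_eq_add] at h
    rw [h]
    abel
  have hJ : ∀ n : ℕ, ∀ f, ‖((n + 1 : ℝ) : ℂ) • R n f‖ ≤ ‖f‖ := by
    intro n f
    rw [norm_smul, Complex.norm_real, Real.norm_of_nonneg (hpos n).le, ← le_div_iff₀' (hpos n),
      ← inv_mul_eq_div]
    exact hR₃ n f
  have hJd : ∀ x : A.domain, Tendsto (fun n : ℕ => ((n + 1 : ℝ) : ℂ) • R n x) atTop (𝓝 x) := by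
    intro x
    rw [tendsto_iff_norm_sub_tendsto_zero]
    refine squeeze_zero (fun _ => norm_nonneg _)
      (g := fun n : ℕ => (1 / ((n : ℝ) + 1)) * ‖A x‖) (fun n => ?_) ?_
    · rw [happ, one_div]
      exact hR₃ n _
    · simpa using tendsto_one_div_add_atTop_nhds_zero_nat.mul_const ‖A x‖
  -- Convergence passes from the dense domain to all of `H` because the operators `r R` are
  -- contractions.
  have hJt : ∀ f, Tendsto (fun n : ℕ => ((n + 1 : ℝ) : ℂ) • R n f) atTop (𝓝 f) := by
    intro f
    rw [Metric.tendsto_atTop]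
    intro ε hε
    obtain ⟨x, hx, hfx⟩ := hA.dense_domain.exists_dist_lt f (show 0 < ε / 3 by positivity)
    obtain ⟨N, hN⟩ := Metric.tendsto_atTop.1 (hJd ⟨x, hx⟩) (ε / 3) (by positivity)
    refine ⟨N, fun n hn => ?_⟩
    have h1 := hN n hn
    have h2 := hJ n (f - x)
    rw [dist_eq_norm] at h1 hfx ⊢
    rw [map_sub, smul_sub] at h2
    have h3 : ((n + 1 : ℝ) : ℂ) • R n f - f = (((n + 1 : ℝ) : ℂ) • R n f
        - ((n + 1 : ℝ) : ℂ) • R n x) + (((n + 1 : ℝ) : ℂ) • R n x - x) - (f - x) := by abel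
    rw [h3]
    refine (norm_sub_le _ _).trans_lt ?_
    have h4 := norm_add_le (((n + 1 : ℝ) : ℂ) • R n f
        - ((n + 1 : ℝ) : ℂ) • R n x) (((n + 1 : ℝ) : ℂ) • R n x - x)
    change ‖((n + 1 : ℝ) : ℂ) • R n x - x‖ < _ at h1
    linarith
  refine ⟨fun n => ((n + 1 : ℝ) : ℂ) • (((n + 1 : ℝ) : ℂ) • R n - 1), fun n x => ?_, fun m n => ?_,
    fun x => ?_⟩
  · have h1 := hJ n x
    have h2 := re_inner_le_norm (𝕜 := ℂ) x (((n + 1 : ℝ) : ℂ) • R n x)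
    have h3 : (⟪x, x⟫_ℂ).re = ‖x‖ ^ 2 := inner_self_eq_norm_sq (𝕜 := ℂ) _
    change (⟪x, ((n + 1 : ℝ) : ℂ) • (((n + 1 : ℝ) : ℂ) • R n x - x)⟫_ℂ).re ≤ 0
    rw [inner_smul_right, Complex.re_ofReal_mul, inner_sub_right, Complex.sub_re, h3]
    rw [RCLike.re_eq_complex_re] at h2
    have h4 := mul_le_mul_of_nonneg_left h1 (norm_nonneg x)
    exact mul_nonpos_of_nonneg_of_nonpos (hpos n).le (by nlinarith)
  · refine Commute.smul_left (Commute.smul_right ?_ _) _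
    refine Commute.sub_left (Commute.sub_right ?_ (Commute.one_right _)) (Commute.one_left _)
    exact ((hcomm m n).smul_left _).smul_right _
  · refine (hJt (A x)).congr fun n => ?_
    change _ = ((n + 1 : ℝ) : ℂ) • (((n + 1 : ℝ) : ℂ) • R n x - (x : H))
    rw [happ]

end Complete

end Abstract

end CoupledWave

namespace CoupledWave

/-! ### Generation of the semigroup, strong and weak solutions, uniqueness. -/

section Abstract

variable {H : Type*} [NormedAddCommGroup H] [InnerProductSpace ℂ H] {A : H →ₗ.[ℂ] H}

variable {T : ℝ → H →L[ℂ] H}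

lemma IsContractionC0Semigroup.norm_apply_le (hT : IsContractionC0Semigroup T) {t : ℝ}
    (ht : 0 ≤ t) (x : H) : ‖T t x‖ ≤ ‖x‖ := by
  simpa using (T t).le_of_opNorm_le (hT.contraction t ht) x

lemma tendsto_diffQuotient_of_hasDerivWithinAt {f : ℝ → H} {y : H}
    (h : HasDerivWithinAt f y (Ici 0) 0) :
    Tendsto (fun t : ℝ => (t : ℂ)⁻¹ • (f t - f 0)) (𝓝[>] 0) (𝓝 y) := by
  have h1 := hasDerivWithinAt_iff_tendsto_slope.1 h
  rw [Ici_sdiff_left] at h1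
  refine h1.congr fun t => ?_
  rw [slope_def_module, sub_zero, ← Complex.ofReal_inv]
  exact (Complex.coe_smul _ _).symm

/-- `T t` is continuous and commutes with the difference quotients of the semigroup at `0`, so it
may be applied to their limit. -/
lemma IsGenerator.exists_apply_eq (hT : IsContractionC0Semigroup T) (hG : IsGenerator A T)
    (x : A.domain) {t : ℝ} (ht : 0 ≤ t) :
    ∃ hx : T t x ∈ A.domain, A ⟨T t x, hx⟩ = T t (A x) := by
  refine (hG _ _).2 ?_
  have h := ((T t).continuous.tendsto _).comp ((hG x (A x)).1 ⟨x.2, rfl⟩)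
  refine h.congr' ?_
  filter_upwards [self_mem_nhdsWithin] with s hs
  have hs' : 0 ≤ s := le_of_lt hs
  have e : T s (T t x) = T t (T s x) := by
    have h1 := congrArg (fun S : H →L[ℂ] H => S x) (hT.add s t hs' ht)
    have h2 := congrArg (fun S : H →L[ℂ] H => S x) (hT.add t s ht hs')
    rw [add_comm] at h2
    exact h1.symm.trans h2
  simp only [Function.comp_apply, map_smul, map_sub, e]

lemma IsStrongSolution.isWeakSolution {U₀ : H} {U : ℝ → H} (hU : IsStrongSolution A U₀ U) :
    IsWeakSolution A U₀ U := by
  refine ⟨hU.contDiffOn.continuousOn, hU.initial, fun φ ψ h t ht => ?_⟩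
  obtain ⟨V, hV, -, hd⟩ := hU.exists_domain
  have hc : ∀ ζ : H, ContinuousOn (fun s => ⟪ζ, U s⟫_ℂ) (Ici 0) := fun ζ =>
    continuousOn_const.inner hU.contDiffOn.continuousOn
  rw [intervalIntegral.integral_eq_sub_of_hasDeriv_right (f := fun s => ⟪φ, U s⟫_ℂ), hU.initial]
  · abel
  · rw [uIcc_of_le ht]
    exact (hc φ).mono Icc_subset_Ici_self
  · intro s hs
    rw [min_eq_left ht] at hs
    have h1 := (hasDerivWithinAt_const s (Ici 0) φ).inner ℂ (hd s hs.1.le)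
    rw [inner_zero_left, add_zero, ← h, hV s hs.1.le] at h1
    exact h1.mono (Ioi_subset_Ici hs.1.le)
  · exact ((hc ψ).mono Icc_subset_Ici_self).intervalIntegrable_of_Icc ht

/-- Both sides of the weak identity depend continuously on the initial datum, and they agree for
data in the dense domain. -/
lemma IsContractionC0Semigroup.isWeakSolution (hT : IsContractionC0Semigroup T)
    (hA : Dense (A.domain : Set H)) (hs : ∀ x : A.domain, IsStrongSolution A x fun t => T t x)
    (U₀ : H) : IsWeakSolution A U₀ fun t => T t U₀ := by
  refine ⟨hT.continuous U₀, by rw [hT.zero]; rfl, fun φ ψ h t ht => ?_⟩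
  have hint : ∀ x, IntervalIntegrable (fun s => ⟪ψ, T s x⟫_ℂ) volume 0 t := fun x =>
    ((continuousOn_const.inner (hT.continuous x)).mono Icc_subset_Ici_self).intervalIntegrable_of_Icc
      ht
  have hc : Continuous fun x => ∫ s in (0 : ℝ)..t, ⟪ψ, T s x⟫_ℂ := by
    refine (LipschitzWith.of_dist_le_mul (K := (‖ψ‖ * t).toNNReal) fun x y => ?_).continuous
    rw [dist_eq_norm, dist_eq_norm, ← intervalIntegral.integral_sub (hint x) (hint y),
      Real.coe_toNNReal _ (by positivity)]
    have := intervalIntegral.norm_integral_le_of_norm_le_const (a := 0) (b := t)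
      (C := ‖ψ‖ * ‖x - y‖) (f := fun s => ⟪ψ, T s x⟫_ℂ - ⟪ψ, T s y⟫_ℂ) fun s hs => by
        rw [uIoc_of_le ht] at hs
        rw [← inner_sub_right, ← map_sub]
        exact (norm_inner_le_norm _ _).trans
          (mul_le_mul_of_nonneg_left (hT.norm_apply_le hs.1.le _) (norm_nonneg _))
    rw [sub_zero, abs_of_nonneg ht] at this
    linarith
  refine congrFun (Continuous.ext_on hA (f := fun x => ⟪φ, T t x⟫_ℂ)
    (g := fun x => ⟪φ, x⟫_ℂ + ∫ s in (0 : ℝ)..t, ⟪ψ, T s x⟫_ℂ)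
    (continuous_const.inner (T t).continuous)
    ((continuous_const.inner continuous_id).add hc) fun x hx => ?_) U₀
  exact (hs ⟨x, hx⟩).isWeakSolution.weak φ ψ h t ht

variable [CompleteSpace H]

lemma continuous_boundedGroup_apply (B : H →L[ℂ] H) (x : H) :
    Continuous fun t => boundedGroup B t x :=
  continuous_iff_continuousAt.2 fun t => (hasDerivAt_boundedGroup_apply B x t).continuousAt

/-- An `ε/3` argument: replace `x` by a nearby `x₀ ∈ D` at a cost uniform in `n` and `t`, then use
`norm_boundedGroup_sub_le` at `x₀`. -/
lemma uniformCauchySeqOn_boundedGroup {B : ℕ → H →L[ℂ] H} {D : Set H} (hD : Dense D)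
    (hB : ∀ n x, (⟪x, B n x⟫_ℂ).re ≤ 0) (hc : ∀ m n, Commute (B m) (B n))
    (hlim : ∀ x ∈ D, CauchySeq fun n => B n x) (x : H) (r : ℝ) :
    UniformCauchySeqOn (fun n t => boundedGroup (B n) t x) atTop (Icc 0 r) := by
  rw [Metric.uniformCauchySeqOn_iff]
  intro ε hε
  obtain ⟨x₀, hx₀, hxx⟩ := hD.exists_dist_lt x (show 0 < ε / 3 by positivity)
  -- A bound for `t` that can be divided by whatever the sign of `r`.
  have hr : 0 < |r| + 1 := by positivity
  obtain ⟨N, hN⟩ := Metric.cauchySeq_iff.1 (hlim x₀ hx₀) (ε / 3 / (|r| + 1)) (by positivity)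
  refine ⟨N, fun m hm n hn t ht => ?_⟩
  have h1 := hN m hm n hn
  have h2 := norm_boundedGroup_sub_le (hB m) (hB n) (hc m n) ht.1 x₀
  have h3 := norm_boundedGroup_apply_le (hB m) ht.1 (x - x₀)
  have h4 := norm_boundedGroup_apply_le (hB n) ht.1 (x - x₀)
  rw [dist_eq_norm] at h1 hxx ⊢
  have h5 : ‖B m x₀ - B n x₀‖ * t ≤ ε / 3 := by
    have htr : t ≤ |r| + 1 := (ht.2.trans (le_abs_self r)).trans (by linarith)
    calc _ ≤ ε / 3 / (|r| + 1) * (|r| + 1) := mul_le_mul h1.le htr ht.1 (by positivity)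
      _ = _ := by field_simp
  have h6 : boundedGroup (B m) t x - boundedGroup (B n) t x
      = boundedGroup (B m) t (x - x₀) + (boundedGroup (B m) t x₀ - boundedGroup (B n) t x₀)
        - boundedGroup (B n) t (x - x₀) := by
    rw [map_sub, map_sub]
    abel
  rw [h6]
  have h7 := norm_sub_le (boundedGroup (B m) t (x - x₀) + (boundedGroup (B m) t x₀
    - boundedGroup (B n) t x₀)) (boundedGroup (B n) t (x - x₀))
  have h8 := norm_add_le (boundedGroup (B m) t (x - x₀)) (boundedGroup (B m) t x₀
    - boundedGroup (B n) t x₀)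
  linarith

/-- An m-dissipative operator generates a contraction semigroup (integrated form). -/
lemma IsMDissipative.exists_semigroup (hA : IsMDissipative A) :
    ∃ T : ℝ → H →L[ℂ] H, IsContractionC0Semigroup T ∧
      ∀ x : A.domain, ∀ t : ℝ, 0 ≤ t → T t x = x + ∫ s in (0 : ℝ)..t, T s (A x) := by
  obtain ⟨B, hB, hc, hlim⟩ := hA.exists_yosida
  have hcau := uniformCauchySeqOn_boundedGroup hA.dense_domain hB hc
    (fun x hx => (hlim ⟨x, hx⟩).cauchySeq)
  -- At negative times, where the limit need not exist, the operator is set to `0`.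
  have hex : ∀ t : ℝ, ∃ S : H →L[ℂ] H, 0 ≤ t →
      ∀ x, Tendsto (fun n => boundedGroup (B n) t x) atTop (𝓝 (S x)) := by
    intro t
    by_cases ht : 0 ≤ t
    · choose S hS using fun x => cauchySeq_tendsto_of_complete
        ((hcau x t).cauchySeq (right_mem_Icc.2 ht))
      exact ⟨continuousLinearMapOfTendsto (fun n => boundedGroup (B n) t) (tendsto_pi_nhds.2 hS),
        fun _ => hS⟩
    · exact ⟨0, fun h => absurd h ht⟩
  choose T hT using hex
  have hcontr : ∀ t, 0 ≤ t → ∀ x, ‖T t x‖ ≤ ‖x‖ := fun t ht x =>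
    le_of_tendsto (hT t ht x).norm
      (Eventually.of_forall fun n => norm_boundedGroup_apply_le (hB n) ht x)
  -- The vectors may vary with `n`; this serves both the semigroup law and the limit under the
  -- integral.
  have hTy : ∀ t, 0 ≤ t → ∀ {y : ℕ → H} {x : H}, Tendsto y atTop (𝓝 x) →
      Tendsto (fun n => boundedGroup (B n) t (y n)) atTop (𝓝 (T t x)) := by
    intro t ht y x hy
    have h1 : Tendsto (fun n => boundedGroup (B n) t (y n - x)) atTop (𝓝 0) :=
      squeeze_zero_norm (fun n => norm_boundedGroup_apply_le (hB n) ht _)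
        (tendsto_iff_norm_sub_tendsto_zero.1 hy)
    simpa using h1.add (hT t ht x)
  refine ⟨T, ⟨?_, ?_, ?_, ?_⟩, ?_⟩
  · refine ContinuousLinearMap.ext fun x => tendsto_nhds_unique (hT 0 le_rfl x) ?_
    simp [boundedGroup_zero]
  · intro s t hs ht
    refine ContinuousLinearMap.ext fun x => tendsto_nhds_unique (hT _ (add_nonneg hs ht) x) ?_
    exact (hTy s hs (hT t ht x)).congr fun n => by rw [boundedGroup_add]; rfl
  · intro x t ht
    -- The endpoint `t + 1` makes the interval a neighbourhood of `t` within `[0, ∞)`.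
    have hcon : ContinuousOn (fun t => T t x) (Icc 0 (t + 1)) :=
      ((hcau x (t + 1)).tendstoUniformlyOn_of_tendsto fun s hs => hT s hs.1 x).continuousOn
        (Frequently.of_forall fun n => (continuous_boundedGroup_apply (B n) x).continuousOn)
    refine (hcon t ⟨ht, by linarith⟩).mono_of_mem_nhdsWithin ?_
    exact mem_of_superset (inter_mem_nhdsWithin _ (Iio_mem_nhds (lt_add_one t)))
      fun s hs => ⟨hs.1, le_of_lt hs.2⟩
  · exact fun t ht => ContinuousLinearMap.opNorm_le_bound _ zero_le_one
      fun x => by rw [one_mul]; exact hcontr t ht x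
  · intro x t ht
    have hint : ∀ n, boundedGroup (B n) t x
        = x + ∫ s in (0 : ℝ)..t, boundedGroup (B n) s (B n x) := by
      intro n
      rw [intervalIntegral.integral_eq_sub_of_hasDerivAt
        (fun s _ => hasDerivAt_boundedGroup_apply (B n) x s)
        ((continuous_boundedGroup_apply (B n) _).intervalIntegrable _ _), boundedGroup_zero]
      simp
    refine tendsto_nhds_unique (hT t ht x) ?_
    simp_rw [hint]
    refine tendsto_const_nhds.add ?_
    refine intervalIntegral.tendsto_integral_filter_of_dominated_convergence
      (fun _ => ‖A x‖ + 1) (Eventually.of_forall fun n =>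
        (continuous_boundedGroup_apply (B n) _).aestronglyMeasurable) ?_
        intervalIntegrable_const ?_
    · filter_upwards [(hlim x).norm.eventually_le_const (lt_add_one ‖A x‖)] with n hn
      refine Eventually.of_forall fun s hs => ?_
      rw [uIoc_of_le ht] at hs
      exact (norm_boundedGroup_apply_le (hB n) hs.1.le _).trans hn
    · refine Eventually.of_forall fun s hs => ?_
      rw [uIoc_of_le ht] at hs
      exact hTy s hs.1.le (hlim x)

/-- `t ↦ x + ∫₀ᵗ g` is `C¹` on `[0, ∞)` when `g` is continuous there. -/
lemma exists_hasDerivAt_integral {g : ℝ → H} (hg : ContinuousOn g (Ici 0)) (x : H) :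
    ∃ F : ℝ → H, ContDiff ℝ 1 F ∧ (∀ t, 0 ≤ t → F t = x + ∫ s in (0 : ℝ)..t, g s) ∧
      ∀ t, 0 ≤ t → HasDerivAt F (g t) t := by
  -- Extending `g` by the constant `g 0` to negative times makes the derivative two-sided even at
  -- `0`.
  have hc : Continuous fun s => g (max s 0) :=
    hg.comp_continuous (continuous_id.max continuous_const) fun s => le_max_right s 0
  have hd : ∀ t, HasDerivAt (fun t => x + ∫ s in (0 : ℝ)..t, g (max s 0)) (g (max t 0)) t :=
    fun t => (intervalIntegral.integral_hasDerivAt_right (hc.intervalIntegrable _ _)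
      (hc.stronglyMeasurableAtFilter _ _) hc.continuousAt).const_add x
  refine ⟨_, contDiff_one_iff_deriv.2 ⟨fun t => (hd t).differentiableAt, ?_⟩, fun t ht => ?_,
    fun t ht => ?_⟩
  · rwa [deriv_eq hd]
  · congr 1
    refine intervalIntegral.integral_congr fun s hs => ?_
    rw [uIcc_of_le ht] at hs
    simp only [max_eq_left hs.1]
  · simpa [max_eq_left ht] using hd t

/-- The semigroup of an m-dissipative operator has that operator as its generator. -/
lemma IsMDissipative.isGenerator (hA : IsMDissipative A) (hT : IsContractionC0Semigroup T)
    (hTA : ∀ x : A.domain, ∀ t : ℝ, 0 ≤ t → T t x = x + ∫ s in (0 : ℝ)..t, T s (A x)) :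
    IsGenerator A T := by
  have hfor : ∀ x : A.domain,
      Tendsto (fun t : ℝ => (t : ℂ)⁻¹ • (T t x - x)) (𝓝[>] 0) (𝓝 (A x)) := by
    intro x
    obtain ⟨F, -, hF, hd⟩ := exists_hasDerivAt_integral (hT.continuous (A x)) (x : H)
    have h0 := tendsto_diffQuotient_of_hasDerivWithinAt (hd 0 le_rfl).hasDerivWithinAt
    rw [hT.zero] at h0
    refine h0.congr' ?_
    filter_upwards [self_mem_nhdsWithin] with t ht
    rw [hF t (le_of_lt ht), ← hTA x t (le_of_lt ht), hF 0 le_rfl]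
    simp
  intro x y
  constructor
  · rintro ⟨hx, rfl⟩
    exact hfor ⟨x, hx⟩
  · intro h
    -- The generator extends `A`. With `x' - A x' = x - y`, the difference `w = x - x'` is mapped to
    -- itself by the generator; since the semigroup is contractive, `‖w‖² = Re ⟨w, w⟩ ≤ 0`.
    obtain ⟨x', hx'⟩ := hA.2 1 one_pos (x - y)
    rw [Complex.ofReal_one, one_smul] at hx'
    set w : H := x - x' with hw
    have hyw : y - A x' = w := by
      rw [hw, eq_sub_iff_add_eq, eq_comm, ← sub_eq_iff_eq_add']
      rw [← sub_sub_cancel x y, ← hx']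
      abel
    have hlim : Tendsto (fun t : ℝ => (t : ℂ)⁻¹ • (T t w - w)) (𝓝[>] 0) (𝓝 w) := by
      have h1 := h.sub (hfor x')
      rw [hyw] at h1
      refine h1.congr fun t => ?_
      rw [← smul_sub, hw, map_sub]
      congr 1
      abel
    have h2 : Tendsto (fun t : ℝ => (⟪w, (t : ℂ)⁻¹ • (T t w - w)⟫_ℂ).re) (𝓝[>] 0)
        (𝓝 (⟪w, w⟫_ℂ).re) :=
      (Complex.continuous_re.tendsto _).comp (tendsto_const_nhds.inner hlim)
    have h3 : (⟪w, w⟫_ℂ).re = ‖w‖ ^ 2 := inner_self_eq_norm_sq (𝕜 := ℂ) _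
    have h4 : (⟪w, w⟫_ℂ).re ≤ 0 := by
      refine le_of_tendsto h2 ?_
      filter_upwards [self_mem_nhdsWithin] with t ht
      have ht' : 0 < t := ht
      have h5 := re_inner_le_norm (𝕜 := ℂ) w (T t w)
      have h6 := hT.norm_apply_le ht'.le w
      rw [RCLike.re_eq_complex_re] at h5
      rw [inner_smul_right, ← Complex.ofReal_inv, Complex.re_ofReal_mul, inner_sub_right,
        Complex.sub_re, h3]
      refine mul_nonpos_of_nonneg_of_nonpos (inv_nonneg.2 ht'.le) ?_
      nlinarith [norm_nonneg w]
    have h7 : w = 0 := by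
      have : ‖w‖ ^ 2 = 0 := le_antisymm (h3 ▸ h4) (sq_nonneg _)
      simpa using this
    have hxx : x = x' := sub_eq_zero.1 h7
    refine ⟨hxx ▸ x'.2, ?_⟩
    have : (⟨x, hxx ▸ x'.2⟩ : A.domain) = x' := Subtype.ext hxx
    rw [this]
    rw [h7] at hyw
    exact (sub_eq_zero.1 hyw).symm

/-- The integral identity makes the orbit `C¹` with derivative `T t (A x)`, which equals `A (T t x)`
because `A` generates `T`. -/
lemma IsContractionC0Semigroup.isStrongSolution (hT : IsContractionC0Semigroup T)
    (hG : IsGenerator A T)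
    (hTA : ∀ x : A.domain, ∀ t : ℝ, 0 ≤ t → T t x = x + ∫ s in (0 : ℝ)..t, T s (A x))
    (x : A.domain) : IsStrongSolution A x fun t => T t x := by
  obtain ⟨F, hF1, hF, hd⟩ := exists_hasDerivAt_integral (hT.continuous (A x)) (x : H)
  have hFT : ∀ t ∈ Ici (0 : ℝ), T t x = F t := fun t ht => by rw [hTA x t ht, hF t ht]
  have hV : ∀ t : ℝ, ∃ V : A.domain, 0 ≤ t → (V : H) = T t x ∧ A V = T t (A x) := by
    intro t
    by_cases ht : 0 ≤ t
    · obtain ⟨hx, h⟩ := hG.exists_apply_eq hT x ht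
      exact ⟨⟨_, hx⟩, fun _ => ⟨rfl, h⟩⟩
    · exact ⟨0, fun h => absurd h ht⟩
  choose V hV using hV
  refine ⟨hF1.contDiffOn.congr hFT, by rw [hT.zero]; rfl, V, fun t ht => (hV t ht).1, ?_, ?_⟩
  · refine ((hT.continuous x).prodMk (hT.continuous (A x))).congr fun t ht => ?_
    rw [(hV t ht).1, (hV t ht).2]
  · intro t ht
    rw [(hV t ht).2]
    exact (hd t ht).hasDerivWithinAt.congr hFT (hFT t ht)

/-- `A** ⊆ A` for an m-dissipative operator. -/
lemma IsMDissipative.exists_apply_eq_of_adjoint (hA : IsMDissipative A) {x y : H}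
    (h : ∀ φ ψ : H, (∀ x : A.domain, ⟪ψ, (x : H)⟫_ℂ = ⟪φ, A x⟫_ℂ) → ⟪φ, y⟫_ℂ = ⟪ψ, x⟫_ℂ) :
    ∃ hx : x ∈ A.domain, A ⟨x, hx⟩ = y := by
  obtain ⟨R, -, hR, -⟩ := hA.exists_resolvent one_pos
  obtain ⟨x', hx'⟩ := hA.2 1 one_pos (x - y)
  simp only [Complex.ofReal_one, one_smul] at hR hx'
  have key : ∀ f : H, ⟪f, x - x'⟫_ℂ = 0 := by
    intro f
    -- For `R = (1 - A)⁻¹`, the vector `R* f` lies in `D(A*)` and `A* R* f = R* f - f`. These test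
    -- vectors suffice to identify `x` with `x'`.
    have hadj : ∀ p : A.domain, ⟪ContinuousLinearMap.adjoint R f - f, (p : H)⟫_ℂ = ⟪ContinuousLinearMap.adjoint R f, A p⟫_ℂ := by
      intro p
      have h1 : ⟪ContinuousLinearMap.adjoint R f, (p : H) - A p⟫_ℂ = ⟪f, (p : H)⟫_ℂ := by
        rw [ContinuousLinearMap.adjoint_inner_left, hR]
      rw [inner_sub_right] at h1
      rw [inner_sub_left, ← h1]
      ring
    have h2 := h _ _ hadj
    have h3 := hadj x'
    have h4 : y - A x' = x - x' := by
      rw [← sub_sub_cancel x y, ← hx']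
      abel
    have h5 : ⟪ContinuousLinearMap.adjoint R f, y - A x'⟫_ℂ = ⟪ContinuousLinearMap.adjoint R f - f, x - x'⟫_ℂ := by
      rw [inner_sub_right, h2, ← h3, inner_sub_right]
    rw [h4, inner_sub_left] at h5
    exact sub_eq_self.1 h5.symm
  have hxx : x = x' := sub_eq_zero.1 (inner_self_eq_zero.1 (key (x - x')))
  refine ⟨hxx ▸ x'.2, ?_⟩
  have : (⟨x, hxx ▸ x'.2⟩ : A.domain) = x' := Subtype.ext hxx
  rw [this, ← sub_sub_cancel x y, ← hx', hxx]
  abel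

/-- Let `F` be the time integral of `U - W`. The weak identity reads `⟨φ, F'⟩ = ⟨A* φ, F⟩`, so `F`
lies in `D(A)` and `F' = A F`. Since `F 0 = 0`, the energy estimate gives `F = 0`, and then `U - W =
A F = 0`. -/
lemma IsMDissipative.weakSolution_unique (hA : IsMDissipative A) {U₀ : H} {U W : ℝ → H}
    (hU : IsWeakSolution A U₀ U) (hW : IsWeakSolution A U₀ W) {t : ℝ} (ht : 0 ≤ t) :
    U t = W t := by
  have hg : ContinuousOn (fun s => U s - W s) (Ici 0) := hU.continuousOn.sub hW.continuousOn
  obtain ⟨F, -, hF, hd⟩ := exists_hasDerivAt_integral hg 0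
  simp only [zero_add] at hF
  have hi : ∀ (ψ : H) {V : ℝ → H} {s : ℝ}, 0 ≤ s → ContinuousOn V (Ici 0) →
      IntervalIntegrable (fun r => ⟪ψ, V r⟫_ℂ) volume 0 s := fun ψ _ _ hs hV =>
    ((continuousOn_const.inner hV).mono Icc_subset_Ici_self).intervalIntegrable_of_Icc hs
  have hgraph : ∀ s, 0 ≤ s → ∃ hx : F s ∈ A.domain, A ⟨F s, hx⟩ = U s - W s := by
    intro s hs
    refine hA.exists_apply_eq_of_adjoint fun φ ψ h => ?_
    have e : ⟪ψ, F s⟫_ℂ = ∫ r in (0 : ℝ)..s, ⟪ψ, U r - W r⟫_ℂ := by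
      rw [hF s hs]
      exact (((innerSL ℂ ψ).intervalIntegral_comp_comm
        ((hg.mono Icc_subset_Ici_self).intervalIntegrable_of_Icc hs)).symm)
    rw [e, inner_sub_right, hU.weak φ ψ h s hs, hW.weak φ ψ h s hs]
    simp only [inner_sub_right]
    rw [intervalIntegral.integral_sub (hi ψ hs hU.continuousOn) (hi ψ hs hW.continuousOn)]
    abel
  have hF0 : ∀ s, 0 ≤ s → F s = 0 := by
    intro s hs
    have := norm_le_of_re_inner_deriv_nonpos (f := F) (fun r hr => (hd r hr).hasDerivWithinAt)
      (fun r hr => by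
        obtain ⟨hx, h⟩ := hgraph r hr
        rw [← h]
        exact hA.1 ⟨F r, hx⟩) hs
    rw [hF 0 le_rfl, intervalIntegral.integral_same, norm_zero] at this
    exact norm_le_zero_iff.1 this
  obtain ⟨hx, h⟩ := hgraph t ht
  have h0 : (⟨F t, hx⟩ : A.domain) = 0 := Subtype.ext (hF0 t ht)
  rw [h0, A.map_zero] at h
  exact (sub_eq_zero.1 h.symm)

/-- The Lumer–Phillips theorem in a Hilbert space, with the well-posedness of the evolution
equation in the weak and in the strong sense. -/
theorem IsMDissipative.exists_semigroup_solutions (hA : IsMDissipative A) :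
    ∃ T : ℝ → H →L[ℂ] H, IsContractionC0Semigroup T ∧ IsGenerator A T ∧
      (∀ U₀ : H, IsWeakSolution A U₀ (fun t => T t U₀) ∧
        ∀ U : ℝ → H, IsWeakSolution A U₀ U → ∀ t : ℝ, 0 ≤ t → U t = T t U₀) ∧
      (∀ U₀ ∈ A.domain, IsStrongSolution A U₀ (fun t => T t U₀) ∧
        ∀ U : ℝ → H, IsStrongSolution A U₀ U → ∀ t : ℝ, 0 ≤ t → U t = T t U₀) := by
  obtain ⟨T, hT, hTA⟩ := hA.exists_semigroup
  have hG := hA.isGenerator hT hTA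
  have hs := hT.isStrongSolution hG hTA
  have hw := hT.isWeakSolution hA.dense_domain hs
  exact ⟨T, hT, hG, fun U₀ => ⟨hw U₀, fun U hU t ht => hA.weakSolution_unique hU (hw U₀) ht⟩,
    fun U₀ h₀ => ⟨hs ⟨U₀, h₀⟩, fun U hU t ht =>
      hA.weakSolution_unique hU.isWeakSolution (hw U₀) ht⟩⟩

end Abstract

end CoupledWave

/-! ### Integration by parts in `H₀¹`, multiplication operators, dissipativity, Lax–Milgram. -/

namespace CoupledWave

variable {L : ℝ}

/-- The complex conjugate of a test function. -/
def TestFunction.conj (φ : 𝓓(interval L, ℂ)) : 𝓓(interval L, ℂ) where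
  toFun x := starRingEnd ℂ (φ x)
  contDiff' := Complex.conjCLE.contDiff.comp φ.contDiff
  hasCompactSupport' := φ.hasCompactSupport.comp_left (g := starRingEnd ℂ) (map_zero _)
  tsupport_subset' :=
    (tsupport_comp_subset (g := starRingEnd ℂ) (map_zero _) φ).trans φ.tsupport_subset

lemma TestFunction.conj_apply (φ : 𝓓(interval L, ℂ)) (x : ℝ) :
    TestFunction.conj φ x = starRingEnd ℂ (φ x) := rfl

lemma TestFunction.deriv_conj (φ : 𝓓(interval L, ℂ)) (x : ℝ) :
    deriv (TestFunction.conj φ) x = starRingEnd ℂ (deriv φ x) :=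
  (Complex.conjCLE.hasFDerivAt.comp_hasDerivAt x
    (TestFunction.differentiable φ x).hasDerivAt).deriv

/-- Weak derivatives are tested by a bilinear integral, whereas the inner product conjugates its
left entry; conjugating the test function passes from one to the other. -/
lemma inner_eq_integral_mul {p w : L2 L} {f : ℝ → ℂ}
    (hp : p =ᵐ[leb L] fun x => starRingEnd ℂ (f x)) : ⟪p, w⟫_ℂ = ∫ x, w x * f x ∂(leb L) := by
  rw [L2.inner_def]
  refine integral_congr_ae ?_
  filter_upwards [hp] with x hx
  rw [hx, RCLike.inner_apply, Complex.conj_conj]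

/-- Integration by parts against functions vanishing at the endpoints. -/
lemma HasWeakDeriv.inner_dx {w g : L2 L} (h : HasWeakDeriv w g) (φ : H10 L) :
    ⟪dx φ, w⟫_ℂ = -⟪(φ : L2 L), g⟫_ℂ := by
  -- The identity is a closed condition on the pair `(φ, φ_x)`, so test functions suffice.
  have hcl : IsClosed {p : L2 L × L2 L | ⟪p.2, w⟫_ℂ = -⟪p.1, g⟫_ℂ} :=
    isClosed_eq (continuous_snd.inner continuous_const) (continuous_fst.inner continuous_const).neg
  refine closure_minimal (s := (testGraph L : Set (L2 L × L2 L))) ?_ hcl (mem_H10_iff.1 φ.2)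
  rintro p ⟨ψ, h₁, h₂⟩
  change ⟪p.2, w⟫_ℂ = -⟪p.1, g⟫_ℂ
  rw [inner_eq_integral_mul (f := deriv (TestFunction.conj ψ)),
    inner_eq_integral_mul (f := TestFunction.conj ψ), h (TestFunction.conj ψ)]
  · filter_upwards [h₁] with x hx
    rw [hx, TestFunction.conj_apply, Complex.conj_conj]
  · filter_upwards [h₂] with x hx
    rw [hx, TestFunction.deriv_conj, Complex.conj_conj]

/-- Converse of `HasWeakDeriv.inner_dx`; it turns a variational equation into `H¹` regularity of the
flux. -/
lemma hasWeakDeriv_of_inner_dx {w g : L2 L}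
    (h : ∀ φ : H10 L, ⟪dx φ, w⟫_ℂ = -⟪(φ : L2 L), g⟫_ℂ) : HasWeakDeriv w g := by
  intro ψ
  let χ := TestFunction.conj ψ
  let p : L2 L × L2 L := 
    ((TestFunction.memLp χ 2).toLp χ, (TestFunction.memLp_deriv χ 2).toLp (deriv χ))
  have h₁ : p.1 =ᵐ[leb L] χ := MemLp.coeFn_toLp (TestFunction.memLp χ 2)
  have h₂ : p.2 =ᵐ[leb L] deriv χ := MemLp.coeFn_toLp (TestFunction.memLp_deriv χ 2)
  have hp : p ∈ testGraph L := ⟨χ, h₁, h₂⟩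
  let φ : H10 L := ⟨p.1, p, subset_closure hp, rfl⟩
  have hφ : dx φ = p.2 := (hasWeakDeriv_of_mem_testGraph hp).weakDeriv_eq
  have h3 := h φ
  rw [hφ] at h3
  change ⟪p.2, w⟫_ℂ = -⟪p.1, g⟫_ℂ at h3
  rw [inner_eq_integral_mul (f := deriv ψ), inner_eq_integral_mul (f := ψ)] at h3
  · exact h3
  · filter_upwards [h₁] with x hx
    rw [hx, TestFunction.conj_apply]
  · filter_upwards [h₂] with x hx
    rw [hx, TestFunction.deriv_conj]

/-! ### Multiplication operators -/

lemma mulLinf_apply_ae (b : Linf L) (w : L2 L) : mulLinf b w =ᵐ[leb L] fun x => b x * w x := by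
  filter_upwards [Lp.coeFn_lpSMul (r := 2) b w] with x hx
  change (b • w : L2 L) x = _
  rw [hx, Pi.smul_apply', Complex.real_smul]

lemma inner_mulLinf_right (b : Linf L) (w₁ w₂ : L2 L) :
    ⟪w₁, mulLinf b w₂⟫_ℂ = ⟪mulLinf b w₁, w₂⟫_ℂ := by
  rw [L2.inner_def, L2.inner_def]
  refine integral_congr_ae ?_
  filter_upwards [mulLinf_apply_ae b w₁, mulLinf_apply_ae b w₂] with x h₁ h₂
  rw [h₁, h₂]
  simp only [RCLike.inner_apply, map_mul, Complex.conj_ofReal]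
  ring

lemma re_inner_mulLinf_nonneg {b : Linf L} (hb : ∀ᵐ x ∂(leb L), 0 ≤ b x) (w : L2 L) :
    0 ≤ (⟪w, mulLinf b w⟫_ℂ).re := by
  have hi := L2.integrable_inner (𝕜 := ℂ) w (mulLinf b w)
  rw [L2.inner_def, ← RCLike.re_eq_complex_re, ← integral_re hi]
  refine integral_nonneg_of_ae ?_
  filter_upwards [hb, mulLinf_apply_ae b w] with x h₁ h₂
  rw [h₂, RCLike.inner_apply, mul_assoc, RCLike.re_eq_complex_re, Complex.re_ofReal_mul,
    Complex.mul_conj, Complex.ofReal_re]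
  exact mul_nonneg h₁ (Complex.normSq_nonneg _)

/-- `mulLinf b` as a bounded operator. -/
def mulLinfL (b : Linf L) : L2 L →L[ℂ] L2 L :=
  (mulLinf b).mkContinuous ‖b‖ fun w => Lp.norm_smul_le b w

@[simp] lemma mulLinfL_apply (b : Linf L) (w : L2 L) : mulLinfL b w = mulLinf b w := rfl

lemma step_nonneg {k : ℝ} (hk : 0 ≤ k) (p q : ℝ) : ∀ᵐ x ∂(leb L), 0 ≤ step L k p q x := by
  filter_upwards [indicatorConstLp_coeFn (p := ⊤) (μ := leb L)
    (hs := measurableSet_Ioo (a := p) (b := q)) (hμs := measure_ne_top (leb L) _) (c := k)] with x hx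
  rw [step, hx]
  exact indicator_nonneg (fun _ _ => hk) x

lemma zero_nonneg : ∀ᵐ x ∂(leb L), 0 ≤ (0 : Linf L) x := by
  filter_upwards [Lp.coeFn_zero ℝ ⊤ (leb L)] with x hx
  rw [hx, Pi.zero_apply]

/-! ### The wave operator -/

variable {a : ℝ} [ha : Fact (0 < a)] {b c d : Linf L}

/-- Integration by parts turns the flux terms into `-⟨v_x, a u_x + b v_x⟩` and `-⟨z_x, y_x + d
z_x⟩`. Their elastic parts cancel in real part against the `u` and `y` terms of the energy product,
and the coupling terms cancel since multiplication by `c` is symmetric. Only the damping remains. -/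
lemma isDissipative_waveOp (hb : ∀ᵐ x ∂(leb L), 0 ≤ b x) (hd : ∀ᵐ x ∂(leb L), 0 ≤ d x) :
    IsDissipative (waveOp a b c d) := by
  rintro ⟨U, hv, hz, hf₁, hf₂⟩
  have e₁ := (hasWeakDeriv_weakDeriv hf₁).inner_dx ⟨U.v, hv⟩
  have e₂ := (hasWeakDeriv_weakDeriv hf₂).inner_dx ⟨U.z, hz⟩
  set V : H10 L := ⟨U.v, hv⟩ with hV
  set Z : H10 L := ⟨U.z, hz⟩ with hZ
  have f₁ : flux a b U.u U.v = (a : ℂ) • dx U.u + mulLinf b (dx V) := rfl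
  have f₂ : flux 1 d U.y U.z = dx U.y + mulLinf d (dx Z) := by
    rw [flux, Complex.ofReal_one, one_smul]
    rfl
  have eV : (V : L2 L) = U.v := rfl
  have eZ : (Z : L2 L) = U.z := rfl
  change (⟪U.v, weakDeriv (flux a b U.u U.v) - mulLinf c U.z⟫_ℂ + (a : ℂ) * ⟪dx U.u, dx V⟫_ℂ
    + ⟪U.z, weakDeriv (flux 1 d U.y U.z) + mulLinf c U.v⟫_ℂ + ⟪dx U.y, dx Z⟫_ℂ).re ≤ 0
  rw [inner_sub_right, inner_add_right (𝕜 := ℂ) U.z, ← eV, ← eZ, ← neg_eq_iff_eq_neg.2 e₁,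
    ← neg_eq_iff_eq_neg.2 e₂, eV, eZ, f₁, f₂, inner_add_right, inner_add_right, inner_smul_right]
  have s₁ : (⟪dx U.u, dx V⟫_ℂ).re = (⟪dx V, dx U.u⟫_ℂ).re := inner_re_symm (𝕜 := ℂ) _ _
  have s₂ : (⟪dx U.y, dx Z⟫_ℂ).re = (⟪dx Z, dx U.y⟫_ℂ).re := inner_re_symm (𝕜 := ℂ) _ _
  have s₃ : (⟪U.z, mulLinf c U.v⟫_ℂ).re = (⟪U.v, mulLinf c U.z⟫_ℂ).re := by
    rw [inner_mulLinf_right]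
    exact inner_re_symm (𝕜 := ℂ) _ _
  have p₁ := re_inner_mulLinf_nonneg hb (dx V)
  have p₂ := re_inner_mulLinf_nonneg hd (dx Z)
  simp only [Complex.add_re, Complex.sub_re, Complex.neg_re, Complex.re_ofReal_mul, s₁, s₂, s₃]
  linarith

/-- The Lax–Milgram theorem for bounded operators. -/
lemma surjective_of_coercive {H : Type*} [NormedAddCommGroup H] [InnerProductSpace ℂ H]
    [CompleteSpace H] {M : H →L[ℂ] H} {k : ℝ} (hk : 0 < k)
    (hM : ∀ x, k * ‖x‖ ^ 2 ≤ (⟪x, M x⟫_ℂ).re) : Function.Surjective M := by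
  have hb : ∀ x, k * ‖x‖ ≤ ‖M x‖ := by
    intro x
    have h1 := (hM x).trans (re_inner_le_norm (𝕜 := ℂ) x (M x))
    rcases (norm_nonneg x).eq_or_lt with h | h
    · rw [← h, mul_zero]
      exact norm_nonneg _
    · nlinarith
  -- The lower bound closes the range; coercivity then rules out a nonzero vector orthogonal to it.
  have hanti : AntilipschitzWith (k⁻¹).toNNReal M := by
    refine ContinuousLinearMap.antilipschitz_of_bound M fun x => ?_
    rw [Real.coe_toNNReal _ (inv_nonneg.2 hk.le), inv_mul_eq_div, le_div_iff₀' hk]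
    exact hb x
  have hcl : IsClosed (M.range : Set H) := hanti.isClosed_range M.uniformContinuous
  have hc := hcl.completeSpace_coe
  refine LinearMap.range_eq_top.1 ?_
  rw [← Submodule.orthogonal_orthogonal M.range, Submodule.orthogonal_eq_top_iff,
    Submodule.eq_bot_iff]
  intro x hx
  have h1 : ⟪M x, x⟫_ℂ = 0 := hx _ ⟨x, rfl⟩
  have h2 := hM x
  have h3 : (⟪x, M x⟫_ℂ).re = 0 := by
    rw [← inner_conj_symm, h1]
    simp
  rw [h3] at h2
  have h4 : ‖x‖ ^ 2 = 0 := le_antisymm (nonpos_of_mul_nonpos_right h2 hk) (sq_nonneg _)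
  simpa using h4

end CoupledWave

/-! ### The resolvent equation of the wave operator by a variational method. -/

namespace CoupledWave

variable {L : ℝ} {a : ℝ} [ha : Fact (0 < a)]

namespace EnergySpace

/-- The second component, as a bounded operator. -/
def vL : EnergySpace a L →L[ℂ] L2 L :=
  LinearMap.mkContinuous { toFun := v, map_add' := v_add, map_smul' := v_smul } 1 norm_v_le

/-- The fourth component, as a bounded operator. -/
def zL : EnergySpace a L →L[ℂ] L2 L :=
  LinearMap.mkContinuous { toFun := z, map_add' := z_add, map_smul' := z_smul } 1 norm_z_le

/-- The derivative of the first component, as a bounded operator. -/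
def dxuL : EnergySpace a L →L[ℂ] L2 L :=
  LinearMap.mkContinuous (dx ∘ₗ { toFun := u, map_add' := u_add, map_smul' := u_smul }) (√a)⁻¹
    norm_dx_u_le

/-- The derivative of the third component, as a bounded operator. -/
def dxyL : EnergySpace a L →L[ℂ] L2 L :=
  LinearMap.mkContinuous (dx ∘ₗ { toFun := y, map_add' := y_add, map_smul' := y_smul }) 1
    norm_dx_y_le

/-- The first component in `L²`, as a bounded operator. -/
def uL : EnergySpace a L →L[ℂ] L2 L :=
  LinearMap.mkContinuous ((H10 L).subtype ∘ₗ
    { toFun := u, map_add' := u_add, map_smul' := u_smul }) ((exists_poincare L).choose * (√a)⁻¹)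
    fun U => ((exists_poincare L).choose_spec.2 U.u U.u.2).trans (by
      rw [mul_assoc]
      exact mul_le_mul_of_nonneg_left (norm_dx_u_le U) (exists_poincare L).choose_spec.1.le)

/-- The third component in `L²`, as a bounded operator. -/
def yL : EnergySpace a L →L[ℂ] L2 L :=
  LinearMap.mkContinuous ((H10 L).subtype ∘ₗ
    { toFun := y, map_add' := y_add, map_smul' := y_smul }) ((exists_poincare L).choose * 1)
    fun U => ((exists_poincare L).choose_spec.2 U.y U.y.2).trans (by
      rw [mul_assoc]
      exact mul_le_mul_of_nonneg_left (norm_dx_y_le U) (exists_poincare L).choose_spec.1.le)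

@[simp] lemma vL_apply (U : EnergySpace a L) : vL U = U.v := rfl
@[simp] lemma zL_apply (U : EnergySpace a L) : zL U = U.z := rfl
@[simp] lemma dxuL_apply (U : EnergySpace a L) : dxuL U = dx U.u := rfl
@[simp] lemma dxyL_apply (U : EnergySpace a L) : dxyL U = dx U.y := rfl
@[simp] lemma uL_apply (U : EnergySpace a L) : uL U = (U.u : L2 L) := rfl
@[simp] lemma yL_apply (U : EnergySpace a L) : yL U = (U.y : L2 L) := rfl

end EnergySpace

open EnergySpace ContinuousLinearMap

/-- The operator of the variational form of the resolvent equation in the unknowns `v` and `z`,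
which are the first and the third component here; the other two are mapped by the identity. -/
def resolventForm (r : ℝ) (b c d : Linf L) : EnergySpace a L →L[ℂ] EnergySpace a L :=
  adjoint uL ∘L ((r : ℂ) • uL + mulLinfL c ∘L yL)
    + adjoint dxuL ∘L (((a / r : ℝ) : ℂ) • dxuL + mulLinfL b ∘L dxuL)
    + adjoint yL ∘L ((r : ℂ) • yL - mulLinfL c ∘L uL)
    + adjoint dxyL ∘L (((1 / r : ℝ) : ℂ) • dxyL + mulLinfL d ∘L dxyL)
    + adjoint vL ∘L vL + adjoint zL ∘L zL

/-- The adjoints realize each `L²` pairing of the form as an operator on the energy space. The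
identity terms in the two spare slots make it coercive for the full energy norm. -/
lemma inner_resolventForm (r : ℝ) (b c d : Linf L) (Φ U : EnergySpace a L) :
    ⟪Φ, resolventForm r b c d U⟫_ℂ = ⟪(Φ.u : L2 L), (r : ℂ) • (U.u : L2 L) + mulLinf c U.y⟫_ℂ
      + ⟪dx Φ.u, ((a / r : ℝ) : ℂ) • dx U.u + mulLinf b (dx U.u)⟫_ℂ
      + ⟪(Φ.y : L2 L), (r : ℂ) • (U.y : L2 L) - mulLinf c U.u⟫_ℂ
      + ⟪dx Φ.y, ((1 / r : ℝ) : ℂ) • dx U.y + mulLinf d (dx U.y)⟫_ℂ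
      + ⟪Φ.v, U.v⟫_ℂ + ⟪Φ.z, U.z⟫_ℂ := by
  simp only [resolventForm, add_apply, sub_apply, coe_comp, Function.comp_apply, smul_apply,
    inner_add_right, adjoint_inner_right, uL_apply, yL_apply, vL_apply, zL_apply,
    dxuL_apply, dxyL_apply, mulLinfL_apply, inner_sub_right]

/-- The coupling terms cancel in real part, and the damping and zero-order terms are nonnegative.
The constant takes `1 / r` from the gradient terms and `1` from the two spare slots. -/
lemma resolventForm_coercive {r : ℝ} (hr : 0 < r) {b c d : Linf L}
    (hb : ∀ᵐ x ∂(leb L), 0 ≤ b x) (hd : ∀ᵐ x ∂(leb L), 0 ≤ d x) (U : EnergySpace a L) :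
    min 1 (1 / r) * ‖U‖ ^ 2 ≤ (⟪U, resolventForm r b c d U⟫_ℂ).re := by
  have s : (⟪(U.y : L2 L), mulLinf c U.u⟫_ℂ).re = (⟪(U.u : L2 L), mulLinf c U.y⟫_ℂ).re := by
    rw [inner_mulLinf_right]
    exact inner_re_symm (𝕜 := ℂ) _ _
  have p₁ := re_inner_mulLinf_nonneg hb (dx U.u)
  have p₂ := re_inner_mulLinf_nonneg hd (dx U.y)
  have e : ∀ w : L2 L, (⟪w, w⟫_ℂ).re = ‖w‖ ^ 2 := fun w => inner_self_eq_norm_sq (𝕜 := ℂ) w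
  rw [inner_resolventForm]
  simp only [inner_add_right, inner_sub_right, inner_smul_right, Complex.add_re, Complex.sub_re,
    Complex.re_ofReal_mul, s, e]
  rw [EnergySpace.norm_sq_eq]
  have m₁ : min 1 (1 / r) ≤ 1 := min_le_left _ _
  have m₂ : min 1 (1 / r) ≤ 1 / r := min_le_right _ _
  have q₁ := mul_le_mul_of_nonneg_right m₁ (sq_nonneg ‖U.v‖)
  have q₂ := mul_le_mul_of_nonneg_right m₁ (sq_nonneg ‖U.z‖)
  have q₃ := mul_le_mul_of_nonneg_right m₂ (mul_nonneg ha.out.le (sq_nonneg ‖dx U.u‖))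
  have q₄ := mul_le_mul_of_nonneg_right m₂ (sq_nonneg ‖dx U.y‖)
  have q₅ : a / r * ‖dx U.u‖ ^ 2 = 1 / r * (a * ‖dx U.u‖ ^ 2) := by ring
  have q₆ := mul_nonneg hr.le (sq_nonneg ‖(U.u : L2 L)‖)
  have q₇ := mul_nonneg hr.le (sq_nonneg ‖(U.y : L2 L)‖)
  linarith

/-- This is the weak form of the second and fourth resolvent equations after substituting `u = (v +
F.u) / r` and `y = (z + F.y) / r`. -/
lemma exists_resolvent_variational {r : ℝ} (hr : 0 < r) {b c d : Linf L}
    (hb : ∀ᵐ x ∂(leb L), 0 ≤ b x) (hd : ∀ᵐ x ∂(leb L), 0 ≤ d x) (F : EnergySpace a L) :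
    ∃ v z : H10 L,
      (∀ φ : H10 L, ⟪(φ : L2 L), (r : ℂ) • (v : L2 L) + mulLinf c z⟫_ℂ
        + ⟪dx φ, ((a / r : ℝ) : ℂ) • dx v + mulLinf b (dx v)⟫_ℂ
        = ⟪(φ : L2 L), F.v⟫_ℂ - ⟪dx φ, ((a / r : ℝ) : ℂ) • dx F.u⟫_ℂ) ∧
      ∀ φ : H10 L, ⟪(φ : L2 L), (r : ℂ) • (z : L2 L) - mulLinf c v⟫_ℂ
        + ⟪dx φ, ((1 / r : ℝ) : ℂ) • dx z + mulLinf d (dx z)⟫_ℂ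
        = ⟪(φ : L2 L), F.z⟫_ℂ - ⟪dx φ, ((1 / r : ℝ) : ℂ) • dx F.y⟫_ℂ := by
  obtain ⟨U, hU⟩ := surjective_of_coercive (show 0 < min 1 (1 / r) by positivity)
    (fun U : EnergySpace a L => resolventForm_coercive (c := c) hr hb hd U)
    (adjoint uL F.v - adjoint dxuL (((a / r : ℝ) : ℂ) • dx F.u)
      + (adjoint yL F.z - adjoint dxyL (((1 / r : ℝ) : ℂ) • dx F.y)))
  have key : ∀ Φ : EnergySpace a L, _ := fun Φ => congrArg (fun W => ⟪Φ, W⟫_ℂ) hU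
  simp only [inner_resolventForm, inner_add_right (𝕜 := ℂ) (_ : EnergySpace a L),
    inner_sub_right (𝕜 := ℂ) (_ : EnergySpace a L), adjoint_inner_right, uL_apply, yL_apply,
    dxuL_apply, dxyL_apply] at key
  -- Test vectors with a single nonzero slot separate the two equations.
  refine ⟨U.u, U.y, fun φ => ?_, fun φ => ?_⟩
  · simpa only [u_mk, v_mk, y_mk, z_mk, map_zero, Submodule.coe_zero, inner_zero_left, add_zero,
      sub_zero] using key (EnergySpace.mk φ 0 0 0)
  · simpa only [u_mk, v_mk, y_mk, z_mk, map_zero, Submodule.coe_zero, inner_zero_left, add_zero,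
      sub_zero, zero_add] using key (EnergySpace.mk 0 0 φ 0)

/-- Moving the datum `f` to the left-hand side completes the gradient term to the full flux of `u =
(v + f) / r`, so the variational equation identifies its weak derivative. -/
lemma hasWeakDeriv_flux {r κ : ℝ} (hr : 0 < r) {b : Linf L} {f v : H10 L} {g h : L2 L}
    (hv : ∀ φ : H10 L, ⟪(φ : L2 L), g⟫_ℂ
      + ⟪dx φ, ((κ / r : ℝ) : ℂ) • dx v + mulLinf b (dx v)⟫_ℂ
      = ⟪(φ : L2 L), h⟫_ℂ - ⟪dx φ, ((κ / r : ℝ) : ℂ) • dx f⟫_ℂ) :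
    HasWeakDeriv (flux κ b ((r⁻¹ : ℂ) • (v + f) : H10 L) v) (g - h) := by
  have hr' : (r : ℂ) ≠ 0 := by exact_mod_cast hr.ne'
  have e : flux κ b ((r⁻¹ : ℂ) • (v + f) : H10 L) v
      = ((κ / r : ℝ) : ℂ) • dx v + mulLinf b (dx v) + ((κ / r : ℝ) : ℂ) • dx f := by
    have h1 : weakDeriv (((r⁻¹ : ℂ) • (v + f) : H10 L) : L2 L) = (r⁻¹ : ℂ) • (dx v + dx f) := by
      rw [← map_add, ← map_smul]
      rfl
    rw [flux, h1, smul_smul]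
    push_cast
    rw [← div_eq_mul_inv, smul_add]
    change _ + mulLinf b (dx v) = _
    abel
  rw [e]
  refine hasWeakDeriv_of_inner_dx fun φ => ?_
  rw [inner_add_right, inner_sub_right]
  linear_combination hv φ

/-- The wave operator is m-dissipative for nonnegative damping coefficients. -/
theorem isMDissipative_waveOp {b c d : Linf L} (hb : ∀ᵐ x ∂(leb L), 0 ≤ b x)
    (hd : ∀ᵐ x ∂(leb L), 0 ≤ d x) : IsMDissipative (waveOp a b c d) := by
  refine ⟨isDissipative_waveOp hb hd, fun r hr F => ?_⟩
  obtain ⟨v, z, hv, hz⟩ := exists_resolvent_variational (c := c) hr hb hd F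
  have h₁ := hasWeakDeriv_flux hr hv
  have h₂ := hasWeakDeriv_flux hr hz
  have hr' : (r : ℂ) ≠ 0 := by exact_mod_cast hr.ne'
  -- The first and third slots are forced by `r u - v = F.u` and `r y - z = F.y`.
  refine ⟨⟨EnergySpace.mk ((r⁻¹ : ℂ) • (v + F.u)) v ((r⁻¹ : ℂ) • (z + F.y)) z,
    v.2, z.2, ⟨_, h₁⟩, ⟨_, h₂⟩⟩, ?_⟩
  refine EnergySpace.ext ?_ ?_ ?_ ?_
  · change (r : ℂ) • (r⁻¹ : ℂ) • (v + F.u) - v = F.u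
    rw [smul_inv_smul₀ hr', add_sub_cancel_left]
  · change (r : ℂ) • (v : L2 L) - (weakDeriv (flux a b ((r⁻¹ : ℂ) • (v + F.u) : H10 L) v)
      - mulLinf c z) = F.v
    rw [h₁.weakDeriv_eq]
    abel
  · change (r : ℂ) • (r⁻¹ : ℂ) • (z + F.y) - z = F.y
    rw [smul_inv_smul₀ hr', add_sub_cancel_left]
  · change (r : ℂ) • (z : L2 L) - (weakDeriv (flux 1 d ((r⁻¹ : ℂ) • (z + F.y) : H10 L) z)
      + mulLinf c v) = F.z
    rw [h₂.weakDeriv_eq]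
    abel

end CoupledWave

end

theorem mainTheorem5 (a L : ℝ) [Fact (0 < a)] (b c d : CoupledWave.Linf L)
    (hcase : CoupledWave.CaseC1 L b c d ∨ CoupledWave.CaseC2 L b c d ∨
      CoupledWave.CaseC3 L b c d) :
    CoupledWave.IsMDissipative (CoupledWave.waveOp a b c d) ∧
    ∃ T : ℝ → CoupledWave.EnergySpace a L →L[ℂ] CoupledWave.EnergySpace a L,
      CoupledWave.IsContractionC0Semigroup T ∧
      CoupledWave.IsGenerator (CoupledWave.waveOp a b c d) T ∧
      (∀ U₀ : CoupledWave.EnergySpace a L,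
        CoupledWave.IsWeakSolution (CoupledWave.waveOp a b c d) U₀ (fun t => T t U₀) ∧
        ∀ U : ℝ → CoupledWave.EnergySpace a L,
          CoupledWave.IsWeakSolution (CoupledWave.waveOp a b c d) U₀ U →
            ∀ t : ℝ, 0 ≤ t → U t = T t U₀) ∧
      (∀ U₀ ∈ (CoupledWave.waveOp a b c d).domain,
        CoupledWave.IsStrongSolution (CoupledWave.waveOp a b c d) U₀ (fun t => T t U₀) ∧
        ∀ U : ℝ → CoupledWave.EnergySpace a L,
          CoupledWave.IsStrongSolution (CoupledWave.waveOp a b c d) U₀ U →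
            ∀ t : ℝ, 0 ≤ t → U t = T t U₀) := by
  obtain ⟨hb, hd⟩ : (∀ᵐ x ∂(CoupledWave.leb L), 0 ≤ b x) ∧ ∀ᵐ x ∂(CoupledWave.leb L), 0 ≤ d x := by
    obtain ⟨b₀, c₀, d₀, b₁, b₂, c₁, c₂, d₁, d₂, hb₀, -, hd₀, -, -, -, -, -, -, -, rfl, -, rfl⟩ |
      ⟨b₀, c₀, d₀, b₁, b₂, c₁, c₂, d₁, d₂, hb₀, -, hd₀, -, -, -, -, -, -, -, rfl, -, rfl⟩ |
      ⟨b₀, c₀, b₁, b₂, c₁, c₂, hb₀, -, -, -, -, -, -, rfl, -, rfl⟩ := hcase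
    · exact ⟨CoupledWave.step_nonneg hb₀.le _ _, CoupledWave.step_nonneg hd₀.le _ _⟩
    · exact ⟨CoupledWave.step_nonneg hb₀.le _ _, CoupledWave.step_nonneg hd₀.le _ _⟩
    · exact ⟨CoupledWave.step_nonneg hb₀.le _ _, CoupledWave.zero_nonneg⟩
  have hA := CoupledWave.isMDissipative_waveOp (a := a) (c := c) hb hd
  exact ⟨hA, hA.exists_semigroup_solutions⟩
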